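/- A 2-CNF on $n$ Boolean variables is a set of clauses, each clause being an unordered pair of literals corresponding to distinct variables. Its implication digraph has as vertices the $2n$ literals, and each clause $k\vee\ell$ contributes the two arcs $\overline{k}\to\ell$ and $\overline{\ell}\to k$. All series below are formal power series in $z$ with coefficients in $\mathbb{Q}[[w]]$. Let $\mathrm{SAT}_{n,m}$ be the number of (implication digraphs of) satisfiable 2-CNFs with $n$ variables and $m$ clauses (so $2n$ vertices and $2m$ arcs), and let $$\ddot{\mathrm{SAT}}(z)=\sum_{n\ge 0}\frac{\sum_{m\ge 0}\mathrm{SAT}_{n,m}w^m}{(1+w)^{n(n-1)}}\,\frac{z^n}{2^n n!}$$ be their Implication generating function. Let $$G(z)=\sum_{n\ge 0}\Big(\sum_{m\ge 0}g_{n,m}w^m\Big)\frac{z^n}{n!}$$ be the exponential generating function of graphs, where $g_{n,m}$ is the number of simple graphs with $n$ labeled vertices and $m$ edges, and let $$\ddot{\mathrm{Set}}(z)=\sum_{n\ge 0}\frac{1}{(1+w)^{n(n-1)}}\,\frac{z^n}{2^n n!}$$ be the Implication generating function of implication digraphs without arcs. Let $\odot_z$ denote the exponential Hadamard product, $$\Big(\sum_{n\ge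 0} a_n(w)\frac{z^n}{n!}\Big)\odot_z\Big(\sum_{n\ge 0} b_n(w)\frac{z^n}{n!}\Big)=\sum_{n\ge 0} a_n(w)b_n(w)\frac{z^n}{n!},$$ and for a series with constant coefficient $1$ (in $z$) let $\sqrt{\cdot}$ denote its square root with constant coefficient $1$. **Theorem.** $$\ddot{\mathrm{SAT}}(z)=G(z)\cdot\left(\sqrt{G(z)\odot_z\frac{1}{G(z)}}\;\odot_z\;\ddot{\mathrm{Set}}(2z)\right).$$ -/

import Mathlib

namespace TwoSat

open PowerSeries

/-! ## 2-CNFs and implication digraphs -/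

/-- Literals on `n` Boolean variables: `(i, true)` is the variable `x_i`,
`(i, false)` is its negation. -/
abbrev Literal (n : ℕ) : Type := Fin n × Bool

/-- The negation of a literal. -/
def negLit {n : ℕ} (l : Literal n) : Literal n := (l.1, !l.2)

/-- A 2-CNF on `n` variables: a set of clauses, each clause being a set of exactly two literals
that correspond to distinct variables. -/
@[ext] structure TwoCNF (n : ℕ) where
  clauses : Finset (Finset (Literal n))
  card_eq_two : ∀ c ∈ clauses, c.card = 2
  distinct_vars : ∀ c ∈ clauses, ∀ k ∈ c, ∀ l ∈ c, k.1 = l.1 → k = l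

/-- Some assignment of Boolean values to the variables makes a literal of each clause true. -/
def TwoCNF.Satisfiable {n : ℕ} (F : TwoCNF n) : Prop :=
  ∃ v : Fin n → Bool, ∀ c ∈ F.clauses, ∃ l ∈ c, v l.1 = l.2

/-- An implication digraph on the `2 n` literals of `n` variables: it has neither loops nor arcs
from a literal to its negation, and with each arc `x → y` it contains the arc `¬y → ¬x`. -/
@[ext] structure ImplicationDigraph (n : ℕ) extends Digraph (Literal n) where
  distinct_vars : ∀ x y, Adj x y → x.1 ≠ y.1
  symm_neg : ∀ x y, Adj x y → Adj (negLit y) (negLit x)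

/-- The set of arcs of an implication digraph. -/
def ImplicationDigraph.arcs {n : ℕ} (D : ImplicationDigraph n) : Set (Literal n × Literal n) :=
  {a | D.Adj a.1 a.2}

theorem negLit_negLit {n : ℕ} (l : Literal n) : negLit (negLit l) = l := by
  simp [negLit]

/-- The implication digraph of a 2-CNF: each clause `k ∨ l` yields the arcs `¬k → l` and `¬l → k`.
Thus `x → y` is an arc exactly when `¬x ∨ y` is a clause. -/
def TwoCNF.implicationDigraph {n : ℕ} (F : TwoCNF n) : ImplicationDigraph n where
  Adj x y := {negLit x, y} ∈ F.clauses
  distinct_vars := by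
    intro x y h hxy
    have h1 := F.distinct_vars _ h (negLit x) (by simp) y (by simp) hxy
    have h2 := F.card_eq_two _ h
    rw [h1] at h2
    simp at h2
  symm_neg := by
    intro x y h
    rw [negLit_negLit, Finset.pair_comm]
    exact h

/-! ## Generating functions, in the ring of formal power series in `z` over `ℚ⟦w⟧` -/

/-- Formal power series in `w` with rational coefficients. -/
abbrev WSeries : Type := PowerSeries ℚ

/-- Formal power series in `z` whose coefficients are formal power series in `w`. -/
abbrev ZWSeries : Type := PowerSeries WSeries

/-- The Exponential generating function `∑_n (∑_m a_{n,m} w^m) z^n / n!`. -/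
noncomputable def exponentialGF (a : ℕ → ℕ → ℕ) : ZWSeries :=
  PowerSeries.mk fun n =>
    ((n.factorial : ℚ)⁻¹) • (PowerSeries.mk fun m => (a n m : ℚ) : WSeries)

/-- The number of members of a family of implication digraphs with `2 n` vertices
and `2 m` arcs. -/
noncomputable def implicationCount (B : ∀ n : ℕ, Set (ImplicationDigraph n)) (n m : ℕ) : ℕ :=
  {D : ImplicationDigraph n | D ∈ B n ∧ D.arcs.ncard = 2 * m}.ncard

/-- The Implication generating function
`∑_n b_n(w) / (1+w)^{n(n-1)} z^n / (2^n n!)` of a family of implication digraphs,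
where `b_n(w) = ∑_m b_{n,m} w^m`. -/
noncomputable def implicationGF (B : ∀ n : ℕ, Set (ImplicationDigraph n)) : ZWSeries :=
  PowerSeries.mk fun n =>
    ((2 ^ n * n.factorial : ℚ)⁻¹) •
      ((PowerSeries.mk fun m => (implicationCount B n m : ℚ) : WSeries) *
        ((1 + PowerSeries.X : WSeries) ^ (n * (n - 1)))⁻¹)

/-- The number of labeled simple graphs with `n` vertices and `m` edges. -/
noncomputable def graphCount (n m : ℕ) : ℕ :=
  {H : SimpleGraph (Fin n) | H.edgeSet.ncard = m}.ncard

/-- `G(z)`: the Exponential generating function of graphs. -/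
noncomputable def graphEGF : ZWSeries := exponentialGF graphCount

/-- The Implication generating function of sets, i.e. of the implication digraphs without arcs. -/
noncomputable def setIGF : ZWSeries := implicationGF fun _ => {D | D.arcs = ∅}

/-- The Implication generating function of satisfiable 2-CNFs, i.e. of the family of implication
digraphs of satisfiable 2-CNFs. -/
noncomputable def satIGF : ZWSeries :=
  implicationGF fun n => {D | ∃ F : TwoCNF n, F.Satisfiable ∧ F.implicationDigraph = D}

/-- The exponential Hadamard product with respect to `z`:
`(∑ a_n z^n/n!) ⊙ (∑ b_n z^n/n!) = ∑ a_n b_n z^n/n!`. -/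
noncomputable def hadamard (A B : ZWSeries) : ZWSeries :=
  PowerSeries.mk fun n =>
    ((n.factorial : ℚ)⁻¹) •
      (((n.factorial : ℚ) • PowerSeries.coeff n A) * ((n.factorial : ℚ) • PowerSeries.coeff n B))

/-- The coefficients of the square root, with constant coefficient `1`, of a power series with
constant coefficient `1`: they solve `∑_{i+j=n} s_i s_j = f_n` successively. -/
noncomputable def sqrtCoeff (A : ZWSeries) : ℕ → WSeries
  | 0 => 1
  | n + 1 => (1 / 2 : ℚ) • (PowerSeries.coeff (n + 1) A -
      ∑ i : Fin n, sqrtCoeff A (i.1 + 1) * sqrtCoeff A (n - i.1))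
  termination_by n => n
  decreasing_by
    · have := i.2
      omega
    · omega

/-- The square root with constant coefficient `1` of a power series with
constant coefficient `1`. -/
noncomputable def sqrtSeries (A : ZWSeries) : ZWSeries := PowerSeries.mk (sqrtCoeff A)

/-- The inverse of a power series with constant coefficient `1`. -/
noncomputable def invSeries (A : ZWSeries) : ZWSeries := PowerSeries.invOfUnit A 1

/-- Substitution of `c z` for `z`. -/
noncomputable def scaleZ (c : ℚ) (A : ZWSeries) : ZWSeries :=
  PowerSeries.rescale (PowerSeries.C c : WSeries) A

/-! ## The square root and the inverse are the genuine ones where they are used -/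

theorem constantCoeff_sqrtSeries (A : ZWSeries) :
    PowerSeries.constantCoeff (sqrtSeries A) = 1 := by
  rw [← PowerSeries.coeff_zero_eq_constantCoeff_apply, sqrtSeries, PowerSeries.coeff_mk, sqrtCoeff]

theorem sqrtSeries_sq (A : ZWSeries) (hA : PowerSeries.constantCoeff A = 1) :
    sqrtSeries A ^ 2 = A := by
  ext1 n
  rw [pow_two, PowerSeries.coeff_mul, sqrtSeries]
  simp only [PowerSeries.coeff_mk]
  rw [Finset.Nat.sum_antidiagonal_eq_sum_range_succ (fun i j => sqrtCoeff A i * sqrtCoeff A j)]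
  cases n with
  | zero =>
    simp only [PowerSeries.coeff_zero_eq_constantCoeff_apply, hA]
    simp [sqrtCoeff]
  | succ n =>
    rw [Finset.sum_range_succ, Finset.sum_range_succ']
    have h0 : sqrtCoeff A 0 = 1 := by rw [sqrtCoeff]
    have h : ∑ k ∈ Finset.range n, sqrtCoeff A (k + 1) * sqrtCoeff A (n + 1 - (k + 1)) =
        ∑ i : Fin n, sqrtCoeff A (i.1 + 1) * sqrtCoeff A (n - i.1) := by
      rw [Finset.sum_range]
      simp
    rw [h]
    simp only [Nat.sub_self, Nat.sub_zero, h0, one_mul, mul_one]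
    rw [sqrtCoeff]
    module

theorem mul_invSeries (A : ZWSeries) (hA : PowerSeries.constantCoeff A = 1) :
    A * invSeries A = 1 :=
  PowerSeries.mul_invOfUnit A 1 (by simpa using hA)

theorem constantCoeff_graphEGF : PowerSeries.constantCoeff graphEGF = 1 := by
  rw [← PowerSeries.coeff_zero_eq_constantCoeff_apply, graphEGF, exponentialGF,
    PowerSeries.coeff_mk]
  ext m
  have h : ∀ H : SimpleGraph (Fin 0), H.edgeSet.ncard = 0 := by
    intro H
    rw [Subsingleton.elim H ⊥]
    simp
  by_cases hm : m = 0
  · subst hm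
    simp [graphCount, h]
  · have h' : ¬ 0 = m := fun e => hm e.symm
    simp [graphCount, h, h', hm, PowerSeries.coeff_one]

theorem constantCoeff_hadamard_graphEGF :
    PowerSeries.constantCoeff (hadamard graphEGF (invSeries graphEGF)) = 1 := by
  have h1 := constantCoeff_graphEGF
  have h2 : PowerSeries.constantCoeff (invSeries graphEGF) = 1 := by
    have := congrArg PowerSeries.constantCoeff (mul_invSeries _ h1)
    simpa [h1] using this
  rw [← PowerSeries.coeff_zero_eq_constantCoeff_apply, hadamard, PowerSeries.coeff_mk]
  simp only [PowerSeries.coeff_zero_eq_constantCoeff_apply, h1, h2]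
  simp

end TwoSat

/-! Call a digraph strong-split if each of its weak components is strongly connected, and let e_k(t)
be the sum of t^(components) w^(arcs) over such digraphs on k vertices (`strongCoeff`). Everything
rests on inclusion-exclusion over source components.

For plain digraphs, choose a set of source components with sign -1 for each. A nonempty digraph has
a source component, so the signed sum is 0. For a fixed union K of source components, the arcs
inside K are strong-split and no arc enters K; the other arcs are free. After division by (1+w)^(n
choose 2) this says that E(z) = sum e_k(-1) (1+w)^(-(k choose 2)) z^k/k! is the inverse of G
(`strong_egf_mul_graphEGF`). Hence the Hadamard product of G and 1/G is the series of e_k(-1).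
Distributing components over two parts doubles the weight of each, so its square root is the series
of e_k(-1/2) (`sqrtSeries_strong_egf`).

For satisfiable 2-CNFs, choose instead a signed set of source components whose union L is free of
complementary literals. With L fixed, the clauses inside L form a strong-split digraph on L. The
other clauses meeting the variables of L are either excluded or free, and setting L to false leaves
a satisfiable formula on the remaining variables (`Consistent.sum_sat`). So the total is a
coefficient of E times the SAT series.

The same total is computed formula by formula. If some arc lies on no closed walk, toggling a source
component from which that arc can be reached cancels everything (`sum_consistent_eq_zero`).
Otherwise the components come in c complementary pairs; each pair offers nothing, one component or
its mirror image, for a total of (1-2)^c = (-1)^c. This is 2^c (-1/2)^c, a sum over the full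
selections, of weight (-1/2)^c each. Each full selection is a total set L carrying a strong-split
digraph together with its mirror image, so summing over formulas gives 2^n e_n(-1/2). Thus E times
SAT is the Hadamard product of the square root with Set(2z) (`strong_egf_mul_satIGF`), and
multiplying by G finishes the proof. -/

namespace TwoSat

open Relation

/-! ## Sums over subsets -/

section Powerset

variable {ι κ R : Type*} [DecidableEq κ] [CommRing R]

theorem sum_powerset_union_of_disjoint [DecidableEq ι] {E₁ E₂ : Finset ι} (h : Disjoint E₁ E₂)
    (f g : Finset ι → R) :
    ∑ A ∈ (E₁ ∪ E₂).powerset, f (A ∩ E₁) * g (A ∩ E₂) =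
      (∑ A ∈ E₁.powerset, f A) * ∑ A ∈ E₂.powerset, g A := by
  rw [Finset.sum_mul_sum, ← Finset.sum_product']
  have hd : ∀ x, x ∈ E₁ → x ∉ E₂ := fun x h1 h2 => Finset.disjoint_left.mp h h1 h2
  refine Finset.sum_bij' (fun A _ => (A ∩ E₁, A ∩ E₂)) (fun p _ => p.1 ∪ p.2) ?_ ?_ ?_ ?_ ?_
  · intro A _
    simp
  · rintro ⟨A, B⟩ hp
    simp only [Finset.mem_product, Finset.mem_powerset] at hp ⊢
    exact Finset.union_subset_union hp.1 hp.2
  · intro A hA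
    rw [Finset.mem_powerset] at hA
    rw [← Finset.inter_union_distrib_left, Finset.inter_eq_left.mpr hA]
  · rintro ⟨A, B⟩ hp
    simp only [Finset.mem_product, Finset.mem_powerset] at hp
    ext x
    · simp only [Finset.mem_inter, Finset.mem_union]
      have h1 := @hp.1 x
      have h2 := @hp.2 x
      have h3 := hd x
      tauto
    · simp only [Finset.mem_inter, Finset.mem_union]
      have h1 := @hp.1 x
      have h2 := @hp.2 x
      have h3 := hd x
      tauto
  · intro A _
    rfl

theorem sum_powerset_pow_card (E : Finset ι) (w : R) :
    ∑ A ∈ E.powerset, w ^ A.card = (1 + w) ^ E.card := by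
  have := Finset.sum_pow_mul_eq_add_pow w 1 E
  simpa [add_comm] using this

theorem card_eq_card_inter_add [DecidableEq ι] {E₁ E₂ A : Finset ι} (h : Disjoint E₁ E₂)
    (hA : A ⊆ E₁ ∪ E₂) :
    A.card = (A ∩ E₁).card + (A ∩ E₂).card := by
  rw [← Finset.card_union_of_disjoint, ← Finset.inter_union_distrib_left,
    Finset.inter_eq_left.mpr hA]
  exact h.mono Finset.inter_subset_right Finset.inter_subset_right

/-- Weighted sums over the subsets of a disjoint union factor. -/
theorem sum_powerset_union_pow_card [DecidableEq ι] {E₁ E₂ : Finset ι} (h : Disjoint E₁ E₂)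
    (f g : Finset ι → R) (w : R) :
    ∑ A ∈ (E₁ ∪ E₂).powerset, f (A ∩ E₁) * g (A ∩ E₂) * w ^ A.card =
      (∑ A ∈ E₁.powerset, f A * w ^ A.card) * ∑ A ∈ E₂.powerset, g A * w ^ A.card := by
  rw [← sum_powerset_union_of_disjoint h]
  refine Finset.sum_congr rfl fun A hA => ?_
  rw [card_eq_card_inter_add h (Finset.mem_powerset.mp hA), pow_add]
  ring

theorem sum_powerset_image {φ : ι → κ} {E : Finset ι} (hφ : Set.InjOn φ E)
    (f : Finset κ → R) :
    ∑ A ∈ (E.image φ).powerset, f A = ∑ A ∈ E.powerset, f (A.image φ) := by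
  rw [Finset.powerset_image, Finset.sum_image]
  intro A hA B hB hAB
  simp only [Finset.coe_powerset, Set.mem_preimage, Set.mem_powerset_iff,
    Finset.coe_subset] at hA hB
  ext x
  have key : ∀ {A B : Finset ι}, A ⊆ E → B ⊆ E → A.image φ = B.image φ → x ∈ A → x ∈ B := by
    intro A B hA hB hAB hx
    have : φ x ∈ B.image φ := hAB ▸ Finset.mem_image_of_mem φ hx
    obtain ⟨y, hy, hyx⟩ := Finset.mem_image.mp this
    rwa [← hφ (hB hy) (hA hx) hyx]
  exact ⟨key hA hB hAB, key hB hA hAB.symm⟩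

theorem sum_powerset_ite_subset {E E' : Finset ι} (h : E' ⊆ E) (f : Finset ι → R)
    (p : Finset ι → Prop) [DecidablePred p] (hp : ∀ A ⊆ E, p A → A ⊆ E') :
    ∑ A ∈ E.powerset, (if p A then f A else 0) =
      ∑ A ∈ E'.powerset, (if p A then f A else 0) := by
  symm
  refine Finset.sum_subset (Finset.powerset_mono.mpr h) fun A hA hA' => ?_
  rw [if_neg]
  intro hpA
  exact hA' (Finset.mem_powerset.mpr (hp A (Finset.mem_powerset.mp hA) hpA))

/-- Serves to compare numbers of classes for two different relations without building a map between
the quotients. -/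
theorem card_image_eq_card_image {ι' κ' : Type*} [DecidableEq κ']
    {g : ι → κ} {g' : ι' → κ'} {K : Finset ι} {K' : Finset ι'} (i : ι → ι')
    (hi : ∀ x ∈ K, i x ∈ K') (hs : ∀ y ∈ K', ∃ x ∈ K, i x = y)
    (h : ∀ x ∈ K, ∀ y ∈ K, g x = g y ↔ g' (i x) = g' (i y)) :
    (K.image g).card = (K'.image g').card := by
  classical
  have h1 : K'.image g' = (K.image fun x => g' (i x)) := by
    ext z
    simp only [Finset.mem_image]
    constructor
    · rintro ⟨y, hy, rfl⟩
      obtain ⟨x, hx, rfl⟩ := hs y hy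
      exact ⟨x, hx, rfl⟩
    · rintro ⟨x, hx, rfl⟩
      exact ⟨i x, hi x hx, rfl⟩
  rw [h1]
  -- By `h`, both projections are injective on the set of pairs (g x, g' (i x)).
  have h2 : ((K.image fun x => (g x, g' (i x))).image Prod.fst).card =
      ((K.image fun x => (g x, g' (i x))).image Prod.snd).card := by
    rw [Finset.card_image_of_injOn (f := Prod.fst), Finset.card_image_of_injOn (f := Prod.snd)]
    · intro p hp q hq hpq
      obtain ⟨x, hx, rfl⟩ := Finset.mem_image.mp (Finset.mem_coe.mp hp)
      obtain ⟨y, hy, rfl⟩ := Finset.mem_image.mp (Finset.mem_coe.mp hq)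
      exact Prod.ext ((h x hx y hy).mpr hpq) hpq
    · intro p hp q hq hpq
      obtain ⟨x, hx, rfl⟩ := Finset.mem_image.mp (Finset.mem_coe.mp hp)
      obtain ⟨y, hy, rfl⟩ := Finset.mem_image.mp (Finset.mem_coe.mp hq)
      exact Prod.ext hpq ((h x hx y hy).mp hpq)
  simpa only [Finset.image_image, Function.comp_def] using h2

end Powerset

/-! ## Classes of mutual reachability -/

section Classes

variable {U : Type*}

/-- Mutual reachability along a relation. -/
def mutualReach (r : U → U → Prop) : Setoid U where
  r x y := ReflTransGen r x y ∧ ReflTransGen r y x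
  iseqv := ⟨fun _ => ⟨.refl, .refl⟩, fun h => ⟨h.2, h.1⟩,
    fun h h' => ⟨h.1.trans h'.1, h'.2.trans h.2⟩⟩

open Classical in
/-- The number of classes of mutual reachability that meet a finite set. -/
noncomputable def classCount (r : U → U → Prop) (K : Finset U) : ℕ :=
  (K.image (Quotient.mk (mutualReach r))).card

/-- A union of source components: each arc that enters the set starts in it
and lies on a closed walk. -/
def IsSourceUnion (r : U → U → Prop) (K : Finset U) : Prop :=
  ∀ x y, r x y → y ∈ K → x ∈ K ∧ ReflTransGen r y x

theorem mk_mutualReach_eq {r : U → U → Prop} {x y : U} :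
    Quotient.mk (mutualReach r) x = Quotient.mk (mutualReach r) y ↔
      ReflTransGen r x y ∧ ReflTransGen r y x :=
  Quotient.eq (r := mutualReach r)

theorem IsSourceUnion.of_reach {r : U → U → Prop} {K : Finset U} (h : IsSourceUnion r K)
    {x y : U} (hxy : ReflTransGen r x y) (hy : y ∈ K) : x ∈ K ∧ ReflTransGen r y x := by
  induction hxy using ReflTransGen.head_induction_on with
  | refl => exact ⟨hy, .refl⟩
  | head hab _ ih =>
    have := h _ _ hab ih.1
    exact ⟨this.1, ih.2.trans this.2⟩

theorem classCount_eq_zero {r : U → U → Prop} {K : Finset U} :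
    classCount r K = 0 ↔ K = ∅ := by
  simp [classCount]

/-- A class that meets a source union is contained in it, so no class meets both sets; nothing is
needed of `K'` beyond disjointness. -/
theorem classCount_union [DecidableEq U] {r : U → U → Prop} {K K' : Finset U}
    (h : IsSourceUnion r K) (hd : Disjoint K K') :
    classCount r (K ∪ K') = classCount r K + classCount r K' := by
  classical
  rw [classCount, Finset.image_union, Finset.card_union_of_disjoint]
  · rfl
  · rw [Finset.disjoint_left]
    intro q hq hq'
    obtain ⟨x, hx, rfl⟩ := Finset.mem_image.mp hq
    obtain ⟨y, hy, hyx⟩ := Finset.mem_image.mp hq'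
    exact Finset.disjoint_left.mp hd (h.of_reach (mk_mutualReach_eq.mp hyx).1 hx).1 hy

theorem IsSourceUnion.union [DecidableEq U] {r : U → U → Prop} {K K' : Finset U}
    (h : IsSourceUnion r K) (h' : IsSourceUnion r K') : IsSourceUnion r (K ∪ K') := by
  intro x y hxy hy
  rcases Finset.mem_union.mp hy with hy | hy
  · exact ⟨Finset.mem_union_left _ (h x y hxy hy).1, (h x y hxy hy).2⟩
  · exact ⟨Finset.mem_union_right _ (h' x y hxy hy).1, (h' x y hxy hy).2⟩

theorem IsSourceUnion.inter [DecidableEq U] {r : U → U → Prop} {K K' : Finset U}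
    (h : IsSourceUnion r K) (h' : IsSourceUnion r K') : IsSourceUnion r (K ∩ K') := by
  intro x y hxy hy
  rw [Finset.mem_inter] at hy ⊢
  exact ⟨⟨(h x y hxy hy.1).1, (h' x y hxy hy.2).1⟩, (h x y hxy hy.1).2⟩

theorem IsSourceUnion.sdiff [DecidableEq U] {r : U → U → Prop} {K K' : Finset U}
    (h : IsSourceUnion r K) (h' : IsSourceUnion r K') : IsSourceUnion r (K \ K') := by
  intro x y hxy hy
  rw [Finset.mem_sdiff] at hy ⊢
  have h1 := h x y hxy hy.1
  exact ⟨⟨h1.1, fun hx => hy.2 (h'.of_reach h1.2 hx).1⟩, h1.2⟩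

open Classical in
/-- The unions of source components contained in a given one correspond to the sets of its
components. -/
theorem sum_pow_classCount [DecidableEq U] {R : Type*} [CommRing R] {r : U → U → Prop}
    {M : Finset U} (hM : IsSourceUnion r M) (t : R) :
    ∑ K ∈ M.powerset, (if IsSourceUnion r K then t ^ classCount r K else 0) =
      (1 + t) ^ classCount r M := by
  rw [classCount, ← sum_powerset_pow_card, ← Finset.sum_filter]
  set mk := Quotient.mk (mutualReach r) with hmk
  refine Finset.sum_bij' (fun K _ => K.image mk) (fun S _ => M.filter fun x => mk x ∈ S)
    ?_ ?_ ?_ ?_ ?_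
  · intro K hK
    exact Finset.mem_powerset.mpr
      (Finset.image_subset_image (Finset.mem_powerset.mp (Finset.mem_filter.mp hK).1))
  · intro S _
    refine Finset.mem_filter.mpr ⟨Finset.mem_powerset.mpr (Finset.filter_subset _ _), ?_⟩
    intro x y hxy hy
    rw [Finset.mem_filter] at hy ⊢
    have h1 := hM x y hxy hy.1
    have h2 : mk x = mk y := mk_mutualReach_eq.mpr ⟨.single hxy, h1.2⟩
    exact ⟨⟨h1.1, h2 ▸ hy.2⟩, h1.2⟩
  · intro K hK
    rw [Finset.mem_filter, Finset.mem_powerset] at hK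
    ext x
    rw [Finset.mem_filter, Finset.mem_image]
    constructor
    · rintro ⟨_, y, hy, hyx⟩
      exact (hK.2.of_reach (mk_mutualReach_eq.mp hyx).2 hy).1
    · intro hx
      exact ⟨hK.1 hx, x, hx, rfl⟩
  · intro S hS
    ext q
    rw [Finset.mem_image]
    constructor
    · rintro ⟨x, hx, rfl⟩
      exact (Finset.mem_filter.mp hx).2
    · intro hq
      obtain ⟨x, hx, rfl⟩ := Finset.mem_image.mp (Finset.mem_powerset.mp hS hq)
      exact ⟨x, Finset.mem_filter.mpr ⟨hx, hq⟩, rfl⟩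
  · intro K _
    rfl

theorem sum_neg_one_pow_classCount [DecidableEq U] {R : Type*} [CommRing R] {r : U → U → Prop}
    {M : Finset U} (hM : IsSourceUnion r M) [DecidablePred (IsSourceUnion r)] :
    ∑ K ∈ M.powerset, (if IsSourceUnion r K then (-1 : R) ^ classCount r K else 0) =
      if M = ∅ then 1 else 0 := by
  classical
  have := sum_pow_classCount hM (-1 : R)
  rw [add_neg_cancel, zero_pow_eq] at this
  simp only [classCount_eq_zero] at this
  convert this

/-! ### Source components of a finite relation -/

section Sources

variable [Fintype U]

open Classical in
/-- The vertices of the source components. -/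
noncomputable def sources (r : U → U → Prop) : Finset U :=
  {y | ∀ x, ReflTransGen r x y → ReflTransGen r y x}

theorem mem_sources {r : U → U → Prop} {y : U} :
    y ∈ sources r ↔ ∀ x, ReflTransGen r x y → ReflTransGen r y x := by
  simp [sources]

theorem isSourceUnion_sources (r : U → U → Prop) : IsSourceUnion r (sources r) := by
  intro x y hxy hy
  rw [mem_sources] at hy
  refine ⟨mem_sources.mpr fun z hz => ?_, hy x (.single hxy)⟩
  exact ReflTransGen.head hxy (hy z (hz.tail hxy))

theorem IsSourceUnion.subset_sources {r : U → U → Prop} {K : Finset U} (h : IsSourceUnion r K) :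
    K ⊆ sources r := fun _ hy => mem_sources.mpr fun _ hx => (h.of_reach hx hy).2

/-- Among the vertices that reach `x`, one with the fewest predecessors works: a vertex reaching it
has no more predecessors, hence by minimality the same ones. -/
theorem exists_mem_sources_reach (r : U → U → Prop) (x : U) :
    ∃ s ∈ sources r, ReflTransGen r s x := by
  classical
  obtain ⟨s, hs, hmin⟩ := Finset.exists_min_image
    (Finset.univ.filter fun s => ReflTransGen r s x)
    (fun s => (Finset.univ.filter fun y => ReflTransGen r y s).card)
    ⟨x, by simp [ReflTransGen.refl]⟩
  rw [Finset.mem_filter] at hs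
  refine ⟨s, mem_sources.mpr fun z hz => ?_, hs.2⟩
  have h1 := hmin z (by simpa using hz.trans hs.2)
  have h2 : (Finset.univ.filter fun y => ReflTransGen r y z) ⊆
      Finset.univ.filter fun y => ReflTransGen r y s := by
    intro y hy
    rw [Finset.mem_filter] at hy ⊢
    exact ⟨hy.1, hy.2.trans hz⟩
  have h3 := Finset.eq_of_subset_of_card_le h2 h1
  have h4 : s ∈ Finset.univ.filter fun y => ReflTransGen r y s := by simp [ReflTransGen.refl]
  rw [← h3] at h4
  exact (Finset.mem_filter.mp h4).2

end Sources

end Classes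

/-! ## Digraphs all of whose weak components are strongly connected -/

section Digraphs

variable {U : Type*}

/-- The relation given by a set of arcs. -/
def arcRel (A : Finset (U × U)) (x y : U) : Prop := (x, y) ∈ A

/-- Reachability is symmetric: each arc lies on a closed walk. -/
def SymmReach (r : U → U → Prop) : Prop := ∀ x y, r x y → ReflTransGen r y x

open Classical in
/-- The arcs between distinct elements of `K`. -/
noncomputable def arcsWithin (r : U → U → Prop) (K : Finset U) : Finset (U × U) :=
  K.offDiag.filter fun p => r p.1 p.2

theorem mem_arcsWithin {r : U → U → Prop} {K : Finset U} {x y : U} :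
    (x, y) ∈ arcsWithin r K ↔ x ∈ K ∧ y ∈ K ∧ x ≠ y ∧ r x y := by
  simp [arcsWithin, and_assoc]

theorem reach_of_arcsWithin {r : U → U → Prop} {K : Finset U} {x y : U}
    (h : ReflTransGen (arcRel (arcsWithin r K)) x y) : ReflTransGen r x y :=
  ReflTransGen.mono (fun _ _ hab => (mem_arcsWithin.mp hab).2.2.2) _ _ h

/-- If no arc enters `K`, a walk ending in `K` never leaves it when followed backwards; loops can be
skipped. -/
theorem reach_arcsWithin_iff {r : U → U → Prop} {K : Finset U}
    (hK : ∀ x y, r x y → y ∈ K → x ∈ K) {x y : U} (hy : y ∈ K) :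
    ReflTransGen r x y ↔ ReflTransGen (arcRel (arcsWithin r K)) x y := by
  refine ⟨fun h => ?_, reach_of_arcsWithin⟩
  have : x ∈ K ∧ ReflTransGen (arcRel (arcsWithin r K)) x y := by
    induction h using ReflTransGen.head_induction_on with
    | refl => exact ⟨hy, .refl⟩
    | @head a c hab _ ih =>
      have ha := hK _ _ hab ih.1
      refine ⟨ha, ?_⟩
      by_cases hac : a = c
      · exact hac ▸ ih.2
      · exact ih.2.head (mem_arcsWithin.mpr ⟨ha, ih.1, hac, hab⟩)
  exact this.2

/-- Separates a condition on the arcs entering `K` from one on the arcs inside `K`. This separation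
is what makes the weighted sums below factor. -/
theorem isSourceUnion_iff {r : U → U → Prop} {K : Finset U} :
    IsSourceUnion r K ↔
      (∀ x y, r x y → y ∈ K → x ∈ K) ∧ SymmReach (arcRel (arcsWithin r K)) := by
  constructor
  · intro h
    have hK : ∀ x y, r x y → y ∈ K → x ∈ K := fun x y hxy hy => (h x y hxy hy).1
    refine ⟨hK, fun x y hxy => ?_⟩
    obtain ⟨hx, hy, _, hr⟩ := mem_arcsWithin.mp hxy
    exact (reach_arcsWithin_iff hK hx).mp (h x y hr hy).2
  · rintro ⟨hK, hs⟩ x y hxy hy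
    have hx := hK x y hxy hy
    refine ⟨hx, ?_⟩
    by_cases h : x = y
    · rw [h]
    · exact reach_of_arcsWithin (hs x y (mem_arcsWithin.mpr ⟨hx, hy, h, hxy⟩))

theorem classCount_arcsWithin {r : U → U → Prop} {K : Finset U}
    (hK : ∀ x y, r x y → y ∈ K → x ∈ K) :
    classCount (arcRel (arcsWithin r K)) K = classCount r K := by
  classical
  refine card_image_eq_card_image id (fun x hx => hx) (fun y hy => ⟨y, hy, rfl⟩) ?_
  intro x hx y hy
  rw [id, id, mk_mutualReach_eq, mk_mutualReach_eq, reach_arcsWithin_iff hK hx,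
    reach_arcsWithin_iff hK hy]

/-! ### Weighted sums over digraphs with strongly connected weak components -/

variable {R : Type*} [CommRing R]

open Classical in
/-- The sum of `t ^ (number of components) * w ^ (number of arcs)` over the digraphs on `K` all of
whose weak components are strongly connected. -/
noncomputable def strongSum (w t : R) (K : Finset U) : R :=
  ∑ A ∈ K.offDiag.powerset,
    (if SymmReach (arcRel A) then t ^ classCount (arcRel A) K else 0) * w ^ A.card

theorem reach_image_iff {U' : Type*} [DecidableEq U'] (f : U ↪ U') {A : Finset (U × U)} {x y : U} :
    ReflTransGen (arcRel (A.image (Prod.map f f))) (f x) (f y) ↔ ReflTransGen (arcRel A) x y := by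
  constructor
  · intro h
    have : ∀ b, ReflTransGen (arcRel (A.image (Prod.map f f))) (f x) b →
        ∃ z, f z = b ∧ ReflTransGen (arcRel A) x z := by
      intro b hb
      induction hb with
      | refl => exact ⟨x, rfl, .refl⟩
      | tail _ hbc ih =>
        obtain ⟨z, rfl, hz⟩ := ih
        obtain ⟨⟨p, q⟩, hpq, he⟩ := Finset.mem_image.mp hbc
        simp only [Prod.map_apply, Prod.mk.injEq] at he
        obtain ⟨hp, rfl⟩ := he
        rw [f.injective hp] at hpq
        exact ⟨q, rfl, hz.tail hpq⟩
    obtain ⟨z, hz, hxz⟩ := this _ h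
    rwa [f.injective hz] at hxz
  · intro h
    exact h.lift f fun a b hab => Finset.mem_image_of_mem (Prod.map f f) hab

theorem symmReach_image_iff {U' : Type*} [DecidableEq U'] (f : U ↪ U') {A : Finset (U × U)} :
    SymmReach (arcRel (A.image (Prod.map f f))) ↔ SymmReach (arcRel A) := by
  constructor
  · intro h x y hxy
    exact (reach_image_iff f).mp (h _ _ (Finset.mem_image_of_mem (Prod.map f f) hxy))
  · intro h x y hxy
    obtain ⟨⟨p, q⟩, hpq, he⟩ := Finset.mem_image.mp hxy
    simp only [Prod.map_apply, Prod.mk.injEq] at he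
    obtain ⟨rfl, rfl⟩ := he
    exact (reach_image_iff f).mpr (h _ _ hpq)

theorem strongSum_map {U' : Type*} (w t : R) (f : U ↪ U') (K : Finset U) :
    strongSum w t (K.map f) = strongSum w t K := by
  classical
  have h : (K.map f).offDiag = K.offDiag.image (Prod.map f f) := by
    ext ⟨x, y⟩
    simp only [Finset.mem_offDiag, Finset.mem_map, Finset.mem_image, Prod.exists, Prod.map_apply,
      Prod.mk.injEq]
    constructor
    · rintro ⟨⟨a, ha, rfl⟩, ⟨b, hb, rfl⟩, hab⟩
      exact ⟨a, b, ⟨ha, hb, fun h => hab (by rw [h])⟩, rfl, rfl⟩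
    · rintro ⟨a, b, ⟨ha, hb, hab⟩, rfl, rfl⟩
      exact ⟨⟨a, ha, rfl⟩, ⟨b, hb, rfl⟩, fun h => hab (f.injective h)⟩
  have hinj : Function.Injective (Prod.map f f) := f.injective.prodMap f.injective
  rw [strongSum, h, sum_powerset_image hinj.injOn, strongSum]
  refine Finset.sum_congr rfl fun A _ => ?_
  rw [Finset.card_image_of_injective _ hinj]
  simp only [symmReach_image_iff]
  have hc : classCount (arcRel (A.image (Prod.map f f))) (K.map f) = classCount (arcRel A) K := by
    symm
    refine card_image_eq_card_image f (fun x hx => Finset.mem_map_of_mem f hx) ?_ ?_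
    · intro y hy
      obtain ⟨x, hx, rfl⟩ := Finset.mem_map.mp hy
      exact ⟨x, hx, rfl⟩
    · intro x _ y _
      rw [mk_mutualReach_eq, mk_mutualReach_eq, reach_image_iff, reach_image_iff]
  rw [hc]

/-- `strongSum` of a set with `k` elements. -/
noncomputable def strongCoeff (w t : R) (k : ℕ) : R :=
  strongSum w t (Finset.univ : Finset (Fin k))

theorem strongSum_eq_strongCoeff (w t : R) (K : Finset U) :
    strongSum w t K = strongCoeff w t K.card := by
  have h : K = Finset.univ.map
      (K.equivFin.symm.toEmbedding.trans (Function.Embedding.subtype (· ∈ K))) := by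
    ext x
    simp only [Finset.mem_map, Finset.mem_univ, true_and, Function.Embedding.trans_apply,
      Equiv.coe_toEmbedding, Function.Embedding.subtype_apply]
    constructor
    · intro hx
      exact ⟨K.equivFin ⟨x, hx⟩, by simp⟩
    · rintro ⟨a, rfl⟩
      exact (K.equivFin.symm a).2
  rw [strongCoeff]
  conv_lhs => rw [h]
  rw [strongSum_map]

theorem strongCoeff_zero (w t : R) : strongCoeff w t 0 = 1 := by
  simp [strongCoeff, strongSum, SymmReach, arcRel, classCount]

-- Arcs into `K` are forbidden and arcs inside `K` carry the strong-connectivity condition. The arcs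
-- from `K` to its complement and those inside the complement are free, which gives the exponent.
open Classical in
theorem sum_sourceUnion_fiber [Fintype U] [DecidableEq U] (w t : R) (K : Finset U) :
    ∑ A ∈ (Finset.univ : Finset U).offDiag.powerset,
      (if IsSourceUnion (arcRel A) K then t ^ classCount (arcRel A) K * w ^ A.card else 0) =
    strongSum w t K * (1 + w) ^ (K.card * Kᶜ.card + Kᶜ.card * (Kᶜ.card - 1)) := by
  set E₂ : Finset (U × U) := K ×ˢ Kᶜ ∪ Kᶜ.offDiag with hE₂
  have hd : Disjoint K.offDiag E₂ := by
    rw [Finset.disjoint_left]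
    rintro ⟨x, y⟩ h h'
    simp only [hE₂, Finset.mem_union, Finset.mem_product, Finset.mem_offDiag,
      Finset.mem_compl] at h h'
    tauto
  have hcard : E₂.card = K.card * Kᶜ.card + Kᶜ.card * (Kᶜ.card - 1) := by
    rw [hE₂, Finset.card_union_of_disjoint, Finset.card_product, Finset.offDiag_card,
      Nat.mul_sub_one]
    rw [Finset.disjoint_left]
    rintro ⟨x, y⟩ h h'
    simp only [Finset.mem_product, Finset.mem_offDiag, Finset.mem_compl] at h h'
    tauto
  have hmem : ∀ x y : U, (x, y) ∈ K.offDiag ∪ E₂ ↔ x ≠ y ∧ (y ∈ K → x ∈ K) := by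
    intro x y
    simp only [hE₂, Finset.mem_union, Finset.mem_product, Finset.mem_offDiag, Finset.mem_compl]
    constructor
    · rintro (h | h | h)
      · tauto
      · exact ⟨fun e => h.2 (e ▸ h.1), by tauto⟩
      · tauto
    · tauto
  rw [sum_powerset_ite_subset (E' := K.offDiag ∪ E₂), ← hcard, ← sum_powerset_pow_card, strongSum]
  · have := sum_powerset_union_pow_card hd
      (fun A => if SymmReach (arcRel A) then t ^ classCount (arcRel A) K else 0) (fun _ => 1) w
    simp only [one_mul, mul_one] at this
    rw [← this]
    refine Finset.sum_congr rfl fun A hA => ?_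
    have hK : ∀ x y, arcRel A x y → y ∈ K → x ∈ K := fun x y hxy =>
      ((hmem x y).mp (Finset.mem_powerset.mp hA hxy)).2
    have hin : arcsWithin (arcRel A) K = A ∩ K.offDiag := by
      ext ⟨x, y⟩
      rw [mem_arcsWithin, Finset.mem_inter, Finset.mem_offDiag, arcRel]
      tauto
    have e1 : IsSourceUnion (arcRel A) K ↔ SymmReach (arcRel (arcsWithin (arcRel A) K)) := by
      rw [isSourceUnion_iff, and_iff_right hK]
    simp only [← hin, e1, ite_mul, zero_mul, classCount_arcsWithin hK]
  · rintro ⟨x, y⟩ h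
    rw [Finset.mem_offDiag]
    exact ⟨Finset.mem_univ _, Finset.mem_univ _, ((hmem x y).mp h).1⟩
  · rintro A hA h ⟨x, y⟩ hxy
    exact (hmem x y).mpr ⟨(Finset.mem_offDiag.mp (hA hxy)).2.2, fun hy => (h x y hxy hy).1⟩

/-- Inclusion-exclusion over the source components of a digraph. -/
theorem sum_strongSum_neg_one [Fintype U] [DecidableEq U] [Nonempty U] (w : R) :
    ∑ K ∈ (Finset.univ : Finset U).powerset,
      strongSum w (-1) K * (1 + w) ^ (K.card * Kᶜ.card + Kᶜ.card * (Kᶜ.card - 1)) = 0 := by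
  classical
  simp only [← sum_sourceUnion_fiber]
  rw [Finset.sum_comm]
  refine Finset.sum_eq_zero fun A _ => ?_
  have h1 := sum_neg_one_pow_classCount (R := R) (isSourceUnion_sources (arcRel A))
  have h2 : sources (arcRel A) ≠ ∅ := by
    obtain ⟨s, hs, _⟩ := exists_mem_sources_reach (arcRel A) (Classical.arbitrary U)
    exact Finset.ne_empty_of_mem hs
  rw [if_neg h2] at h1
  -- Only subsets of the set of all sources contribute, so the alternating binomial sum `h1`
  -- applies.
  rw [sum_powerset_ite_subset (Finset.subset_univ (sources (arcRel A))) _ _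
    fun K _ hK => hK.subset_sources]
  simp only [← ite_zero_mul, ← Finset.sum_mul]
  rw [h1, zero_mul]

theorem IsSourceUnion.symmReach [Fintype U] [DecidableEq U] {r : U → U → Prop} {K : Finset U}
    (h : IsSourceUnion r K) (h' : IsSourceUnion r Kᶜ) : SymmReach r := by
  intro x y hxy
  by_cases hy : y ∈ K
  · exact (h x y hxy hy).2
  · exact (h' x y hxy (Finset.mem_compl.mpr hy)).2

theorem SymmReach.isSourceUnion_univ [Fintype U] {r : U → U → Prop} (h : SymmReach r) :
    IsSourceUnion r Finset.univ := fun x y hxy _ => ⟨Finset.mem_univ _, h x y hxy⟩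

-- When neither `K` nor its complement is entered, no arc joins them: the digraph is a pair of
-- independent digraphs, and the class counts add.
open Classical in
theorem strongSum_mul_strongSum_compl [Fintype U] [DecidableEq U] (w t : R) (K : Finset U) :
    strongSum w t K * strongSum w t Kᶜ =
      ∑ A ∈ (Finset.univ : Finset U).offDiag.powerset,
        if IsSourceUnion (arcRel A) K ∧ IsSourceUnion (arcRel A) Kᶜ then
          t ^ classCount (arcRel A) Finset.univ * w ^ A.card else 0 := by
  have hd : Disjoint K.offDiag Kᶜ.offDiag := by
    rw [Finset.disjoint_left]
    rintro ⟨x, y⟩ h h'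
    simp only [Finset.mem_offDiag, Finset.mem_compl] at h h'
    tauto
  symm
  rw [sum_powerset_ite_subset (E' := K.offDiag ∪ Kᶜ.offDiag), strongSum, strongSum,
    ← sum_powerset_union_pow_card hd]
  · refine Finset.sum_congr rfl fun A hA => ?_
    have hmem : ∀ x y, arcRel A x y → (x ∈ K ↔ y ∈ K) := fun x y hxy => by
      have := Finset.mem_powerset.mp hA hxy
      simp only [Finset.mem_union, Finset.mem_offDiag, Finset.mem_compl] at this
      tauto
    have hK : ∀ x y, arcRel A x y → y ∈ K → x ∈ K := fun x y hxy => (hmem x y hxy).mpr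
    have hK' : ∀ x y, arcRel A x y → y ∈ Kᶜ → x ∈ Kᶜ := fun x y hxy => by
      rw [Finset.mem_compl, Finset.mem_compl]
      exact fun hy hx => hy ((hmem x y hxy).mp hx)
    have hin : ∀ K : Finset U, A ⊆ Finset.univ.offDiag →
        A ∩ K.offDiag = arcsWithin (arcRel A) K := by
      intro K _
      ext ⟨x, y⟩
      rw [mem_arcsWithin, Finset.mem_inter, Finset.mem_offDiag, arcRel]
      tauto
    have hAu : A ⊆ Finset.univ.offDiag := by
      rintro ⟨x, y⟩ hxy
      have := Finset.mem_powerset.mp hA hxy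
      simp only [Finset.mem_union, Finset.mem_offDiag] at this ⊢
      exact ⟨Finset.mem_univ _, Finset.mem_univ _, by tauto⟩
    rw [hin K hAu, hin Kᶜ hAu]
    simp only [classCount_arcsWithin hK, classCount_arcsWithin hK']
    have e1 : IsSourceUnion (arcRel A) K ↔ SymmReach (arcRel (arcsWithin (arcRel A) K)) := by
      rw [isSourceUnion_iff, and_iff_right hK]
    have e2 : IsSourceUnion (arcRel A) Kᶜ ↔
        SymmReach (arcRel (arcsWithin (arcRel A) Kᶜ)) := by
      rw [isSourceUnion_iff, and_iff_right hK']
    rw [← e1, ← e2]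
    by_cases h1 : IsSourceUnion (arcRel A) K
    · by_cases h2 : IsSourceUnion (arcRel A) Kᶜ
      · rw [if_pos ⟨h1, h2⟩, if_pos h1, if_pos h2, ← pow_add,
          ← classCount_union h1 disjoint_compl_right, Finset.union_compl]
      · simp [h2]
    · simp [h1]
  · exact Finset.union_subset (Finset.offDiag_mono (Finset.subset_univ _))
      (Finset.offDiag_mono (Finset.subset_univ _))
  · rintro A hA ⟨h, h'⟩ ⟨x, y⟩ hxy
    have hne := (Finset.mem_offDiag.mp (hA hxy)).2.2
    rw [Finset.mem_union, Finset.mem_offDiag, Finset.mem_offDiag]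
    by_cases hy : y ∈ K
    · exact Or.inl ⟨(h x y hxy hy).1, hy, hne⟩
    · have hy' := Finset.mem_compl.mpr hy
      exact Or.inr ⟨(h' x y hxy hy').1, hy', hne⟩

/-- Splitting the components in all possible ways into two parts doubles the weight of each. -/
theorem sum_strongSum_mul_compl [Fintype U] [DecidableEq U] (w t : R) :
    ∑ K ∈ (Finset.univ : Finset U).powerset, strongSum w t K * strongSum w t Kᶜ =
      strongSum w (2 * t) (Finset.univ : Finset U) := by
  classical
  simp only [strongSum_mul_strongSum_compl]
  rw [Finset.sum_comm, strongSum]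
  refine Finset.sum_congr rfl fun A _ => ?_
  by_cases h : SymmReach (arcRel A)
  · have hu := h.isSourceUnion_univ
    have h1 : ∀ K, (IsSourceUnion (arcRel A) K ∧ IsSourceUnion (arcRel A) Kᶜ) ↔
        IsSourceUnion (arcRel A) K := by
      intro K
      refine and_iff_left_of_imp fun hK => ?_
      rw [← Finset.top_eq_univ] at hu
      rw [← top_sdiff]
      exact hu.sdiff hK
    have h2 := sum_pow_classCount hu (1 : R)
    simp only [one_pow] at h2
    -- The factor 2 ^ (number of components) counts the unions of components, by the binomial
    -- identity at 1.
    rw [if_pos h, mul_pow, ← one_add_one_eq_two, ← h2, mul_assoc, Finset.sum_mul]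
    refine Finset.sum_congr rfl fun K _ => ?_
    simp only [h1, ite_mul, one_mul, zero_mul]
  · rw [if_neg h, zero_mul]
    refine Finset.sum_eq_zero fun K _ => if_neg ?_
    rintro ⟨h1, h2⟩
    exact h (h1.symmReach h2)

end Digraphs

/-! ## Consistent sets of literals -/

section Consistent

variable {n : ℕ}

theorem negLit_injective : Function.Injective (negLit : Literal n → Literal n) :=
  Function.LeftInverse.injective negLit_negLit

theorem eq_or_eq_negLit {x y : Literal n} (h : x.1 = y.1) : x = y ∨ x = negLit y := by
  by_cases h2 : x.2 = y.2
  · exact Or.inl (Prod.ext h h2)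
  · refine Or.inr (Prod.ext h ?_)
    simpa [negLit] using Bool.eq_not_of_ne h2

/-- A set of literals without complementary pairs. -/
def Consistent (L : Finset (Literal n)) : Prop := ∀ x ∈ L, negLit x ∉ L

/-- The negations of a set of literals. -/
def negSet (L : Finset (Literal n)) : Finset (Literal n) := L.image negLit

theorem mem_negSet {L : Finset (Literal n)} {x : Literal n} : x ∈ negSet L ↔ negLit x ∈ L := by
  rw [negSet, Finset.mem_image]
  constructor
  · rintro ⟨y, hy, rfl⟩
    rwa [negLit_negLit]
  · intro h
    exact ⟨_, h, negLit_negLit x⟩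

theorem card_negSet (L : Finset (Literal n)) : (negSet L).card = L.card :=
  Finset.card_image_of_injective _ negLit_injective

/-- The variables of a set of literals. -/
def literalVars (L : Finset (Literal n)) : Finset (Fin n) := L.image Prod.fst

theorem fst_mem_literalVars {L : Finset (Literal n)} {x : Literal n} :
    x.1 ∈ literalVars L ↔ x ∈ L ∨ negLit x ∈ L := by
  rw [literalVars, Finset.mem_image]
  constructor
  · rintro ⟨y, hy, hyx⟩
    rcases eq_or_eq_negLit hyx with rfl | rfl
    · exact Or.inl hy
    · exact Or.inr hy
  · rintro (h | h)
    · exact ⟨x, h, rfl⟩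
    · exact ⟨negLit x, h, rfl⟩

theorem Consistent.card_literalVars {L : Finset (Literal n)} (h : Consistent L) :
    (literalVars L).card = L.card := by
  refine Finset.card_image_of_injOn fun x hx y hy hxy => ?_
  rcases eq_or_eq_negLit hxy with e | e
  · exact e
  · exact absurd (e ▸ hx) (h y hy)

/-- A consistent set with a literal of each variable. -/
def IsTotal (T : Finset (Literal n)) : Prop := ∀ x, negLit x ∈ T ↔ x ∉ T

theorem IsTotal.consistent {T : Finset (Literal n)} (h : IsTotal T) : Consistent T :=
  fun x hx hx' => (h x).mp hx' hx

theorem IsTotal.card_eq {T : Finset (Literal n)} (h : IsTotal T) : T.card = n := by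
  rw [← h.consistent.card_literalVars]
  have : literalVars T = Finset.univ := by
    ext i
    have := @fst_mem_literalVars n T (i, true)
    simp only [Finset.mem_univ, iff_true]
    rw [show i = ((i, true) : Literal n).1 from rfl, this, h]
    tauto
  rw [this, Finset.card_univ, Fintype.card_fin]

theorem Consistent.isTotal {L : Finset (Literal n)} (h : Consistent L) (hc : L.card = n) :
    IsTotal L := by
  have h1 : literalVars L = Finset.univ := by
    rw [← Finset.card_eq_iff_eq_univ, h.card_literalVars, hc, Fintype.card_fin]
  intro x
  refine ⟨fun hx hx' => h x hx' hx, fun hx => ?_⟩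
  have h2 : x.1 ∈ literalVars L := h1 ▸ Finset.mem_univ _
  rcases fst_mem_literalVars.mp h2 with h3 | h3
  · exact absurd h3 hx
  · exact h3

theorem IsTotal.disjoint_negSet {T K P : Finset (Literal n)} (hT : IsTotal T) (hK : K ⊆ T)
    (hP : P ⊆ T) : Disjoint P (negSet K) := by
  rw [Finset.disjoint_left]
  intro x hx hx'
  exact (hT x).mp (hK (mem_negSet.mp hx')) (hP hx)

open Classical in
/-- A consistent set is given by a subset `K` of a total set `T` and by the part of `K` that it
contains; it contains the negations of the rest of `K`. -/
theorem sum_consistent {R : Type*} [CommRing R] {T : Finset (Literal n)} (hT : IsTotal T)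
    (f : Finset (Literal n) → R) :
    ∑ L ∈ Finset.univ.filter (fun L : Finset (Literal n) => Consistent L), f L =
      ∑ K ∈ T.powerset, ∑ P ∈ K.powerset, f (P ∪ negSet (K \ P)) := by
  rw [Finset.sum_sigma']
  refine Finset.sum_bij' (fun L _ => ⟨(L ∪ negSet L) ∩ T, L ∩ T⟩)
    (fun p _ => p.2 ∪ negSet (p.1 \ p.2)) ?_ ?_ ?_ ?_ ?_
  · intro L _
    simp only [Finset.mem_sigma, Finset.mem_powerset]
    exact ⟨Finset.inter_subset_right,
      Finset.inter_subset_inter_right Finset.subset_union_left⟩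
  · rintro ⟨K, P⟩ h
    simp only [Finset.mem_sigma, Finset.mem_powerset] at h
    obtain ⟨hK, hP⟩ := h
    simp only [Finset.mem_filter, Finset.mem_univ, true_and]
    intro x hx hx'
    simp only [Finset.mem_union, mem_negSet, Finset.mem_sdiff, negLit_negLit] at hx hx'
    have h1 := hT x
    have h2 := @hK x
    have h3 := @hK (negLit x)
    have h4 := @hP x
    have h5 := @hP (negLit x)
    tauto
  · intro L hL
    simp only [Finset.mem_filter, Finset.mem_univ, true_and] at hL
    ext x
    simp only [Finset.mem_union, mem_negSet, Finset.mem_sdiff, Finset.mem_inter, negLit_negLit]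
    have h1 := hT x
    have h2 := hL x
    tauto
  · rintro ⟨K, P⟩ h
    simp only [Finset.mem_sigma, Finset.mem_powerset] at h
    obtain ⟨hK, hP⟩ := h
    have e1 : ((P ∪ negSet (K \ P)) ∪ negSet (P ∪ negSet (K \ P))) ∩ T = K := by
      ext x
      simp only [Finset.mem_union, mem_negSet, Finset.mem_sdiff, Finset.mem_inter, negLit_negLit]
      have h1 := hT x
      have h2 := @hK x
      have h3 := @hK (negLit x)
      have h4 := @hP x
      have h5 := @hP (negLit x)
      tauto
    have e2 : (P ∪ negSet (K \ P)) ∩ T = P := by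
      ext x
      simp only [Finset.mem_union, mem_negSet, Finset.mem_sdiff, Finset.mem_inter]
      have h1 := hT x
      have h2 := @hK x
      have h3 := @hK (negLit x)
      have h4 := @hP x
      have h5 := @hP (negLit x)
      tauto
    simp only [e1, e2]
  · intro L hL
    simp only [Finset.mem_filter, Finset.mem_univ, true_and] at hL
    congr 1
    ext x
    simp only [Finset.mem_union, mem_negSet, Finset.mem_sdiff, Finset.mem_inter, negLit_negLit]
    have h1 := hT x
    have h2 := hL x
    tauto

-- A consistent set of k literals is a set of k variables with a sign for each, whence the factor 2
-- ^ k.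
open Classical in
theorem sum_consistent_card {R : Type*} [CommRing R] (f : ℕ → R) :
    ∑ L ∈ Finset.univ.filter (fun L : Finset (Literal n) => Consistent L), f L.card =
      ∑ K ∈ (Finset.univ : Finset (Fin n)).powerset, 2 ^ K.card * f K.card := by
  set T : Finset (Literal n) := Finset.univ.filter fun x => x.2 = true with hTdef
  have hT : IsTotal T := by
    intro x
    simp [hTdef, negLit]
  rw [sum_consistent hT]
  have h1 : ∀ K ∈ T.powerset, ∑ P ∈ K.powerset, f (P ∪ negSet (K \ P)).card =
      2 ^ K.card * f K.card := by
    intro K hK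
    rw [Finset.mem_powerset] at hK
    have h2 : ∀ P ∈ K.powerset, f (P ∪ negSet (K \ P)).card = f K.card := by
      intro P hP
      rw [Finset.mem_powerset] at hP
      rw [Finset.card_union_of_disjoint
        (hT.disjoint_negSet (Finset.sdiff_subset.trans hK) (hP.trans hK)), card_negSet,
        Finset.card_sdiff_of_subset hP, Nat.add_sub_of_le (Finset.card_le_card hP)]
    rw [Finset.sum_congr rfl h2, Finset.sum_const, Finset.card_powerset, nsmul_eq_mul]
    push_cast
    rfl
  rw [Finset.sum_congr rfl h1, Finset.sum_powerset_apply_card (fun k => 2 ^ k * f k),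
    Finset.sum_powerset_apply_card (fun k => 2 ^ k * f k), hT.card_eq, Finset.card_univ,
    Fintype.card_fin]

/-! ## Skew-symmetric relations on literals -/

/-- A relation on literals with `¬y → ¬x` whenever `x → y`. -/
def SkewSymm (r : Literal n → Literal n → Prop) : Prop :=
  ∀ x y, r x y → r (negLit y) (negLit x)

variable {r : Literal n → Literal n → Prop}

theorem SkewSymm.reach (hr : SkewSymm r) {x y : Literal n} (h : ReflTransGen r x y) :
    ReflTransGen r (negLit y) (negLit x) := by
  induction h with
  | refl => exact .refl
  | tail _ hbc ih => exact ih.head (hr _ _ hbc)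

theorem SkewSymm.reach_negLit_iff (hr : SkewSymm r) {x y : Literal n} :
    ReflTransGen r (negLit x) (negLit y) ↔ ReflTransGen r y x :=
  ⟨fun h => by simpa only [negLit_negLit] using hr.reach h, hr.reach⟩

theorem SkewSymm.classCount_negSet (hr : SkewSymm r) (K : Finset (Literal n)) :
    classCount r (negSet K) = classCount r K := by
  classical
  symm
  refine card_image_eq_card_image negLit (fun x hx => ?_) (fun y hy => ?_) fun x _ y _ => ?_
  · rwa [mem_negSet, negLit_negLit]
  · exact ⟨negLit y, mem_negSet.mp hy, negLit_negLit y⟩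
  · rw [mk_mutualReach_eq, mk_mutualReach_eq, hr.reach_negLit_iff, hr.reach_negLit_iff, and_comm]

/-- Negation reverses arcs and so exchanges sources and sinks; under symmetric reachability these
are the same. -/
theorem SkewSymm.isSourceUnion_negSet (hr : SkewSymm r) (hs : SymmReach r)
    {K : Finset (Literal n)} (hK : IsSourceUnion r K) : IsSourceUnion r (negSet K) := by
  intro x y hxy hy
  rw [mem_negSet] at hy ⊢
  exact ⟨(hK.of_reach (hr.reach (hs x y hxy)) hy).1, hs x y hxy⟩

/-- A set of literals closed under implication. -/
def UpClosed (r : Literal n → Literal n → Prop) (T : Finset (Literal n)) : Prop :=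
  ∀ x y, r x y → x ∈ T → y ∈ T

theorem UpClosed.reach {T : Finset (Literal n)} (h : UpClosed r T) {x y : Literal n}
    (hxy : ReflTransGen r x y) (hx : x ∈ T) : y ∈ T := by
  induction hxy with
  | refl => exact hx
  | tail _ hbc ih => exact h _ _ hbc ih

-- All sets on the left have the same variables as `K`. Since classes lie entirely in `T` or in its
-- negation, such a set is a source union only if it takes, for each class in `K`, either that class
-- or its mirror image. There are 2 ^ (number of classes) choices, all with the same number of
-- classes.
open Classical in
theorem sum_signs (hr : SkewSymm r) (hs : SymmReach r) {T : Finset (Literal n)} (hT : IsTotal T)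
    (hup : UpClosed r T) {R : Type*} [CommRing R] (t : R) {K : Finset (Literal n)} (hK : K ⊆ T) :
    ∑ P ∈ K.powerset, (if IsSourceUnion r (P ∪ negSet (K \ P)) then
      t ^ classCount r (P ∪ negSet (K \ P)) else 0) =
    if IsSourceUnion r K then (2 * t) ^ classCount r K else 0 := by
  have hTu : IsSourceUnion r T := fun x y hxy hy => ⟨hup.reach (hs x y hxy) hy, hs x y hxy⟩
  have key : ∀ P ⊆ K, IsSourceUnion r (P ∪ negSet (K \ P)) ↔
      IsSourceUnion r P ∧ IsSourceUnion r K := by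
    intro P hP
    constructor
    · intro h
      have e1 : (P ∪ negSet (K \ P)) ∩ T = P := by
        ext x
        simp only [Finset.mem_union, mem_negSet, Finset.mem_sdiff, Finset.mem_inter]
        have h1 := hT x
        have h2 := @hP x
        have h3 := @hK x
        have h4 := @hK (negLit x)
        tauto
      have e2 : negSet (P ∪ negSet (K \ P)) ∩ T = K \ P := by
        ext x
        simp only [Finset.mem_union, mem_negSet, Finset.mem_sdiff, Finset.mem_inter,
          negLit_negLit]
        have h1 := hT x
        have h2 := @hP (negLit x)
        have h3 := @hK x
        have h4 := @hK (negLit x)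
        tauto
      have h1 : IsSourceUnion r P := e1 ▸ h.inter hTu
      have h2 : IsSourceUnion r (K \ P) := e2 ▸ (hr.isSourceUnion_negSet hs h).inter hTu
      exact ⟨h1, Finset.union_sdiff_of_subset hP ▸ h1.union h2⟩
    · rintro ⟨h1, h2⟩
      exact h1.union (hr.isSourceUnion_negSet hs (h2.sdiff h1))
  by_cases hKu : IsSourceUnion r K
  · rw [if_pos hKu, mul_pow, ← one_add_one_eq_two, ← sum_pow_classCount hKu, Finset.sum_mul]
    refine Finset.sum_congr rfl fun P hP => ?_
    have hP' := Finset.mem_powerset.mp hP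
    rw [key P hP', one_pow]
    by_cases hPu : IsSourceUnion r P
    · rw [if_pos ⟨hPu, hKu⟩, if_pos hPu, one_mul, classCount_union hPu
        (hT.disjoint_negSet (Finset.sdiff_subset.trans hK) (hP'.trans hK)),
        hr.classCount_negSet, ← classCount_union hPu Finset.disjoint_sdiff,
        Finset.union_sdiff_of_subset hP']
    · rw [if_neg fun h => hPu h.1, if_neg hPu, zero_mul]
  · rw [if_neg hKu]
    refine Finset.sum_eq_zero fun P hP => if_neg fun h => hKu ?_
    exact ((key P (Finset.mem_powerset.mp hP)).mp h).2

-- A sign-reversing involution: take an arc x → y on no closed walk, a source component `C` from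
-- which x is reachable, and add or remove `C`.
open Classical in
theorem sum_consistent_eq_zero (hr : SkewSymm r) (hs : ¬ SymmReach r) {R : Type*} [CommRing R] :
    ∑ L ∈ Finset.univ.filter (fun L : Finset (Literal n) => Consistent L),
      (if IsSourceUnion r L then (-1 : R) ^ classCount r L else 0) = 0 := by
  simp only [SymmReach, not_forall] at hs
  obtain ⟨x, y, hxy, hyx⟩ := hs
  obtain ⟨s, hsrc, hsx⟩ := exists_mem_sources_reach r x
  set C : Finset (Literal n) :=
    Finset.univ.filter fun z => ReflTransGen r s z ∧ ReflTransGen r z s with hC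
  have hmem : ∀ z, z ∈ C ↔ ReflTransGen r s z ∧ ReflTransGen r z s := by simp [hC]
  have hsC : s ∈ C := (hmem s).mpr ⟨.refl, .refl⟩
  have hCu : IsSourceUnion r C := by
    intro a b hab hb
    rw [hmem] at hb ⊢
    have h1 : ReflTransGen r a s := hb.2.head hab
    have h2 := mem_sources.mp hsrc a h1
    exact ⟨⟨h2, h1⟩, hb.2.trans h2⟩
  -- This is why adding `C` preserves consistency. Each z in `C` reaches y, so ¬y reaches ¬z; were
  -- ¬z a source, ¬z would reach ¬y, hence y would reach z and then x.
  have hneg : ∀ z ∈ C, negLit z ∉ sources r := by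
    intro z hz hz'
    rw [hmem] at hz
    have h1 : ReflTransGen r z y := (hz.2.trans hsx).tail hxy
    have h2 := hr.reach_negLit_iff.mp (mem_sources.mp hz' _ (hr.reach h1))
    exact hyx ((h2.trans hz.2).trans hsx)
  have hcls : classCount r C = 1 := by
    have : C.image (Quotient.mk (mutualReach r)) = {Quotient.mk (mutualReach r) s} := by
      ext q
      rw [Finset.mem_image, Finset.mem_singleton]
      constructor
      · rintro ⟨z, hz, rfl⟩
        exact mk_mutualReach_eq.mpr ((hmem z).mp hz).symm
      · rintro rfl
        exact ⟨s, hsC, rfl⟩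
    rw [classCount, this, Finset.card_singleton]
  have hsub : ∀ L, IsSourceUnion r L → s ∈ L → C ⊆ L := fun L hL hsL z hz =>
    (hL.of_reach ((hmem z).mp hz).2 hsL).1
  have hdis : ∀ L, IsSourceUnion r L → s ∉ L → Disjoint L C := by
    intro L hL hsL
    rw [Finset.disjoint_left]
    intro z hz hzC
    exact hsL (hL.of_reach ((hmem z).mp hzC).1 hz).1
  have hremove : ∀ L, IsSourceUnion r L → s ∈ L →
      (-1 : R) ^ classCount r L + (-1) ^ classCount r (L \ C) = 0 := by
    intro L hL hsL
    have h1 := classCount_union (hL.sdiff hCu) (Finset.sdiff_disjoint (s := C) (t := L))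
    rw [Finset.sdiff_union_of_subset (hsub L hL hsL), hcls] at h1
    rw [h1, pow_succ]
    ring
  rw [← Finset.sum_filter, Finset.filter_filter]
  refine Finset.sum_involution (fun L _ => if s ∈ L then L \ C else L ∪ C) ?_ ?_ ?_ ?_
  · intro L hL
    simp only [Finset.mem_filter, Finset.mem_univ, true_and] at hL
    split_ifs with h
    · exact hremove L hL.2 h
    · have h1 := hremove (L ∪ C) (hL.2.union hCu) (Finset.mem_union_right _ hsC)
      rw [Finset.union_sdiff_cancel_right (hdis L hL.2 h)] at h1
      rw [add_comm]
      exact h1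
  · intro L hL _ he
    split_ifs at he with h
    · rw [← he] at h
      exact (Finset.mem_sdiff.mp h).2 hsC
    · exact h (he ▸ Finset.mem_union_right _ hsC)
  · intro L hL
    simp only [Finset.mem_filter, Finset.mem_univ, true_and] at hL ⊢
    split_ifs with h
    · exact ⟨fun z hz hz' => hL.1 z (Finset.mem_sdiff.mp hz).1 (Finset.mem_sdiff.mp hz').1,
        hL.2.sdiff hCu⟩
    · have hu := hL.2.union hCu
      refine ⟨fun z hz hz' => ?_, hu⟩
      rcases Finset.mem_union.mp hz with h1 | h1
      · rcases Finset.mem_union.mp hz' with h2 | h2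
        · exact hL.1 z h1 h2
        · refine hneg _ h2 ?_
          rw [negLit_negLit]
          exact hu.subset_sources hz
      · exact hneg z h1 (hu.subset_sources hz')
  · intro L hL
    simp only [Finset.mem_filter, Finset.mem_univ, true_and] at hL
    by_cases h : s ∈ L
    · rw [if_pos h, if_neg fun h' => (Finset.mem_sdiff.mp h').2 hsC,
        Finset.sdiff_union_of_subset (hsub L hL.2 h)]
    · rw [if_neg h, if_pos (Finset.mem_union_right _ hsC),
        Finset.union_sdiff_cancel_right (hdis L hL.2 h)]

open Classical in
/-- Inclusion-exclusion over the source components of a skew-symmetric relation that has a total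
set of literals closed under implication. -/
theorem sum_consistent_neg_one (hr : SkewSymm r) {T : Finset (Literal n)} (hT : IsTotal T)
    (hup : UpClosed r T) {R : Type*} [CommRing R] {t : R} (ht : 2 * t = -1) :
    ∑ L ∈ Finset.univ.filter (fun L : Finset (Literal n) => Consistent L),
      (if IsSourceUnion r L then (-1 : R) ^ classCount r L else 0) =
    ∑ L ∈ Finset.univ.filter (fun L : Finset (Literal n) => Consistent L),
      (if L.card = n ∧ IsSourceUnion r L ∧ IsSourceUnion r Lᶜ then t ^ classCount r L else 0) := by
  by_cases hs : SymmReach r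
  · have hTu : IsSourceUnion r T := fun x y hxy hy => ⟨hup.reach (hs x y hxy) hy, hs x y hxy⟩
    have hu := hs.isSourceUnion_univ
    -- On the left each source union K ⊆ T contributes (-2) ^ classes, for a total of (1 - 2) ^ c
    -- with c the number of classes in `T`. On the right only K = T has n elements, and it
    -- contributes (2 t) ^ c.
    rw [sum_consistent hT, sum_consistent hT,
      Finset.sum_congr rfl fun K hK => sum_signs hr hs hT hup (-1) (Finset.mem_powerset.mp hK),
      sum_pow_classCount hTu, Finset.sum_eq_single_of_mem T (Finset.mem_powerset_self T)]
    · have h1 := sum_signs hr hs hT hup t (subset_refl T)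
      rw [if_pos hTu, ht] at h1
      rw [show (1 + 2 * (-1) : R) = -1 by ring, ← h1]
      refine Finset.sum_congr rfl fun P hP => if_congr ?_ rfl rfl
      have hP' := Finset.mem_powerset.mp hP
      rw [Finset.card_union_of_disjoint (hT.disjoint_negSet Finset.sdiff_subset hP'),
        card_negSet, Finset.card_sdiff_of_subset hP', Nat.add_sub_of_le (Finset.card_le_card hP'),
        hT.card_eq]
      constructor
      · intro h
        refine ⟨rfl, h, ?_⟩
        rw [Finset.compl_eq_univ_sdiff]
        exact hu.sdiff h
      · exact fun h => h.2.1
    · intro K hK hKT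
      have hK' := Finset.mem_powerset.mp hK
      refine Finset.sum_eq_zero fun P hP => if_neg ?_
      have hP' := Finset.mem_powerset.mp hP
      rw [Finset.card_union_of_disjoint
        (hT.disjoint_negSet (Finset.sdiff_subset.trans hK') (hP'.trans hK')),
        card_negSet, Finset.card_sdiff_of_subset hP', Nat.add_sub_of_le (Finset.card_le_card hP')]
      rintro ⟨h, _⟩
      exact hKT (Finset.eq_of_subset_of_card_le hK' (by rw [h, hT.card_eq]))
  · rw [sum_consistent_eq_zero hr hs]
    symm
    refine Finset.sum_eq_zero fun L _ => if_neg ?_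
    rintro ⟨_, h1, h2⟩
    exact hs (h1.symmReach h2)

end Consistent

/-! ## Sets of clauses -/

section Clauses

variable {n : ℕ}

/-- A clause: two literals of distinct variables. -/
def IsClause (c : Finset (Literal n)) : Prop :=
  c.card = 2 ∧ ∀ k ∈ c, ∀ l ∈ c, k.1 = l.1 → k = l

theorem isClause_pair {x y : Literal n} (h : x.1 ≠ y.1) : IsClause {x, y} := by
  refine ⟨Finset.card_pair fun e => h (congrArg Prod.fst e), ?_⟩
  intro k hk l hl hkl
  simp only [Finset.mem_insert, Finset.mem_singleton] at hk hl
  rcases hk with rfl | rfl <;> rcases hl with rfl | rfl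
  · rfl
  · exact absurd hkl h
  · exact absurd hkl.symm h
  · rfl

theorem IsClause.exists_pair {c : Finset (Literal n)} (h : IsClause c) :
    ∃ x y, x.1 ≠ y.1 ∧ c = {x, y} := by
  obtain ⟨x, y, hxy, rfl⟩ := Finset.card_eq_two.mp h.1
  exact ⟨x, y, fun e => hxy (h.2 x (by simp) y (by simp) e), rfl⟩

open Classical in
/-- The clauses on a set of variables. -/
noncomputable def clausesOn (B : Finset (Fin n)) : Finset (Finset (Literal n)) :=
  Finset.univ.filter fun c => IsClause c ∧ ∀ x ∈ c, x.1 ∈ B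

theorem mem_clausesOn {B : Finset (Fin n)} {c : Finset (Literal n)} :
    c ∈ clausesOn B ↔ IsClause c ∧ ∀ x ∈ c, x.1 ∈ B := by
  simp [clausesOn]

/-- The implications of a set of clauses. -/
def implies (F : Finset (Finset (Literal n))) (x y : Literal n) : Prop := {negLit x, y} ∈ F

theorem skewSymm_implies (F : Finset (Finset (Literal n))) : SkewSymm (implies F) := by
  intro x y h
  rw [implies, negLit_negLit, Finset.pair_comm]
  exact h

/-- Some assignment makes a literal of each clause true. -/
def Sat (F : Finset (Finset (Literal n))) : Prop :=
  ∃ v : Fin n → Bool, ∀ c ∈ F, ∃ l ∈ c, v l.1 = l.2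

open Classical in
/-- The sum of `w ^ (number of clauses)` over the satisfiable sets of clauses on `B`. -/
noncomputable def satSum {R : Type*} [CommRing R] (w : R) (B : Finset (Fin n)) : R :=
  ∑ F ∈ (clausesOn B).powerset, (if Sat F then 1 else 0) * w ^ F.card

/-- Renaming of variables in a clause. -/
def renameClause {m : ℕ} (f : Fin m ↪ Fin n) (c : Finset (Literal m)) : Finset (Literal n) :=
  c.map (f.prodMap (.refl Bool))

theorem mem_renameClause {m : ℕ} {f : Fin m ↪ Fin n} {c : Finset (Literal m)} {i : Fin m}
    {b : Bool} : (f i, b) ∈ renameClause f c ↔ (i, b) ∈ c := by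
  rw [renameClause, Finset.mem_map]
  constructor
  · rintro ⟨⟨j, b'⟩, h, he⟩
    simp only [Function.Embedding.prodMap, Function.Embedding.coeFn_mk, Prod.map_apply,
      Function.Embedding.refl_apply, Prod.mk.injEq, EmbeddingLike.apply_eq_iff_eq] at he
    obtain ⟨rfl, rfl⟩ := he
    exact h
  · intro h
    exact ⟨(i, b), h, rfl⟩

theorem isClause_renameClause {m : ℕ} (f : Fin m ↪ Fin n) {c : Finset (Literal m)} :
    IsClause (renameClause f c) ↔ IsClause c := by
  rw [IsClause, IsClause, renameClause, Finset.card_map]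
  refine and_congr_right fun _ => ?_
  simp only [Finset.forall_mem_map, EmbeddingLike.apply_eq_iff_eq]
  simp [Function.Embedding.prodMap]

theorem clausesOn_map {m : ℕ} (f : Fin m ↪ Fin n) :
    clausesOn (Finset.univ.map f) = (clausesOn Finset.univ).image (renameClause f) := by
  ext c
  simp only [mem_clausesOn, Finset.mem_image, Finset.mem_univ, implies_true, and_true,
    Finset.mem_map, true_and]
  constructor
  · rintro ⟨h, hc⟩
    have : c ⊆ (Finset.univ : Finset (Literal m)).map (f.prodMap (.refl Bool)) := by
      rintro ⟨i, b⟩ hx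
      obtain ⟨j, rfl⟩ := hc _ hx
      exact Finset.mem_map.mpr ⟨(j, b), Finset.mem_univ _, rfl⟩
    obtain ⟨d, _, rfl⟩ := Finset.subset_map_iff.mp this
    exact ⟨d, (isClause_renameClause f).mp h, rfl⟩
  · rintro ⟨d, hd, rfl⟩
    refine ⟨(isClause_renameClause f).mpr hd, fun x hx => ?_⟩
    obtain ⟨⟨j, b⟩, _, rfl⟩ := Finset.mem_map.mp hx
    exact ⟨j, rfl⟩

theorem sat_image_renameClause {m : ℕ} (f : Fin m ↪ Fin n) {F : Finset (Finset (Literal m))} :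
    Sat (F.image (renameClause f)) ↔ Sat F := by
  constructor
  · rintro ⟨v, hv⟩
    refine ⟨fun i => v (f i), fun c hc => ?_⟩
    obtain ⟨l, hl, hvl⟩ := hv _ (Finset.mem_image_of_mem _ hc)
    obtain ⟨⟨j, b⟩, hj, rfl⟩ := Finset.mem_map.mp hl
    exact ⟨(j, b), hj, hvl⟩
  · rintro ⟨v, hv⟩
    refine ⟨Function.extend f v fun _ => true, fun c hc => ?_⟩
    obtain ⟨d, hd, rfl⟩ := Finset.mem_image.mp hc
    obtain ⟨⟨j, b⟩, hj, hvj⟩ := hv d hd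
    refine ⟨(f j, b), mem_renameClause.mpr hj, ?_⟩
    rw [f.injective.extend_apply]
    exact hvj

/-- `satSum` of a set of `k` variables. -/
noncomputable def satCoeff {R : Type*} [CommRing R] (w : R) (k : ℕ) : R :=
  satSum w (Finset.univ : Finset (Fin k))

theorem satSum_eq_satCoeff {R : Type*} [CommRing R] (w : R) (B : Finset (Fin n)) :
    satSum w B = satCoeff w B.card := by
  classical
  have hinj : ∀ {m : ℕ} (f : Fin m ↪ Fin n), Function.Injective (renameClause f) :=
    fun f => Finset.map_injective _
  rw [satCoeff]
  conv_lhs => rw [← Finset.map_orderEmbOfFin_univ B rfl]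
  rw [satSum, clausesOn_map, sum_powerset_image (hinj _).injOn, satSum]
  refine Finset.sum_congr rfl fun F _ => ?_
  rw [Finset.card_image_of_injective _ (hinj _)]
  congr 1
  exact if_congr (sat_image_renameClause _) rfl rfl

/-! ## Clauses relative to a consistent set of literals -/

/-- The clause of an implication. -/
def arcClause (p : Literal n × Literal n) : Finset (Literal n) := {negLit p.1, p.2}

/-- The clauses of the implications within `L`. -/
def insideClauses (L : Finset (Literal n)) : Finset (Finset (Literal n)) :=
  L.offDiag.image arcClause

/-- The clauses with a literal negated in `L` and no literal in `L`. -/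
def freeClauses (L : Finset (Literal n)) : Finset (Finset (Literal n)) :=
  (negSet L).powersetCard 2 ∪
    (L ×ˢ ((literalVars L)ᶜ ×ˢ (Finset.univ : Finset Bool))).image arcClause

variable {L : Finset (Literal n)}

/-- A clause stands for two contrapositive arcs, but consistency leaves at most one of them inside
`L`: of ¬x and y, only y belongs to `L`. -/
theorem Consistent.injOn_arcClause (h : Consistent L) :
    Set.InjOn arcClause (L.offDiag : Set (Literal n × Literal n)) := by
  rintro ⟨x, y⟩ hp ⟨x', y'⟩ hp' he
  simp only [Finset.coe_offDiag, Set.mem_offDiag, Finset.mem_coe] at hp hp'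
  simp only [arcClause] at he
  have h1 : y ∈ ({negLit x', y'} : Finset (Literal n)) := he ▸ by simp
  have h2 : negLit x ∈ ({negLit x', y'} : Finset (Literal n)) := he ▸ by simp
  simp only [Finset.mem_insert, Finset.mem_singleton] at h1 h2
  have h3 : y = y' := h1.resolve_left fun e => h x' hp'.1 (e ▸ hp.2.1)
  have h4 : negLit x = negLit x' := h2.resolve_right fun e => h x hp.1 (e ▸ hp'.2.1)
  rw [h3, negLit_injective h4]

theorem Consistent.fst_ne (h : Consistent L) {x y : Literal n} (hx : x ∈ L) (hy : y ∈ L)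
    (hxy : x ≠ y) : x.1 ≠ y.1 := by
  intro e
  rcases eq_or_eq_negLit e with e | e
  · exact hxy e
  · exact h y hy (e ▸ hx)

theorem mem_insideClauses_of_pair {x y : Literal n} (hx : x ∈ L) (hy : y ∈ L) (hxy : x ≠ y) :
    ({negLit x, y} : Finset (Literal n)) ∈ insideClauses L :=
  Finset.mem_image.mpr ⟨(x, y), Finset.mem_offDiag.mpr ⟨hx, hy, hxy⟩, rfl⟩

theorem exists_of_mem_insideClauses {c : Finset (Literal n)} (hc : c ∈ insideClauses L) :
    ∃ x ∈ L, ∃ y ∈ L, x ≠ y ∧ c = {negLit x, y} := by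
  obtain ⟨⟨x, y⟩, hp, rfl⟩ := Finset.mem_image.mp hc
  rw [Finset.mem_offDiag] at hp
  exact ⟨x, hp.1, y, hp.2.1, hp.2.2, rfl⟩

theorem Consistent.notMem_of_mem_freeClauses (h : Consistent L) {c : Finset (Literal n)}
    (hc : c ∈ freeClauses L) : ∀ y ∈ c, y ∉ L := by
  intro y hy hyL
  rcases Finset.mem_union.mp hc with hc | hc
  · rw [Finset.mem_powersetCard] at hc
    exact h y hyL (mem_negSet.mp (hc.1 hy))
  · obtain ⟨⟨a, b⟩, hp, rfl⟩ := Finset.mem_image.mp hc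
    simp only [Finset.mem_product, Finset.mem_compl, Finset.mem_univ, and_true] at hp
    simp only [arcClause, Finset.mem_insert, Finset.mem_singleton] at hy
    rcases hy with rfl | rfl
    · exact h a hp.1 hyL
    · exact hp.2 (fst_mem_literalVars.mpr (Or.inl hyL))

theorem exists_negLit_mem_of_mem_freeClauses {c : Finset (Literal n)} (hc : c ∈ freeClauses L) :
    ∃ x ∈ L, negLit x ∈ c := by
  rcases Finset.mem_union.mp hc with hc | hc
  · rw [Finset.mem_powersetCard] at hc
    obtain ⟨y, hy⟩ : c.Nonempty := by
      rw [← Finset.card_pos, hc.2]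
      norm_num
    exact ⟨negLit y, mem_negSet.mp (hc.1 hy), by rwa [negLit_negLit]⟩
  · obtain ⟨⟨a, b⟩, hp, rfl⟩ := Finset.mem_image.mp hc
    rw [Finset.mem_product] at hp
    exact ⟨a, hp.1, by simp [arcClause]⟩

theorem notMem_of_mem_clausesOn {c : Finset (Literal n)} (hc : c ∈ clausesOn (literalVars L)ᶜ) :
    ∀ y ∈ c, y ∉ L ∧ negLit y ∉ L := by
  intro y hy
  have := Finset.mem_compl.mp ((mem_clausesOn.mp hc).2 y hy)
  rwa [fst_mem_literalVars, not_or] at this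

theorem Consistent.mem_insideClauses_iff (h : Consistent L) {c : Finset (Literal n)}
    (hc : c ∈ insideClauses L ∪ (freeClauses L ∪ clausesOn (literalVars L)ᶜ)) :
    c ∈ insideClauses L ↔ ∃ y ∈ c, y ∈ L := by
  constructor
  · intro hc'
    obtain ⟨x, _, y, hy, _, rfl⟩ := exists_of_mem_insideClauses hc'
    exact ⟨y, by simp, hy⟩
  · rintro ⟨y, hy, hyL⟩
    rcases Finset.mem_union.mp hc with hc | hc
    · exact hc
    · rcases Finset.mem_union.mp hc with hc | hc
      · exact absurd hyL (h.notMem_of_mem_freeClauses hc y hy)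
      · exact absurd hyL (notMem_of_mem_clausesOn hc y hy).1

theorem Consistent.disjoint_inside (h : Consistent L) :
    Disjoint (insideClauses L) (freeClauses L ∪ clausesOn (literalVars L)ᶜ) := by
  rw [Finset.disjoint_left]
  intro c hc hc'
  obtain ⟨x, _, y, hy, _, rfl⟩ := exists_of_mem_insideClauses hc
  rcases Finset.mem_union.mp hc' with hc' | hc'
  · exact h.notMem_of_mem_freeClauses hc' y (by simp) hy
  · exact (notMem_of_mem_clausesOn hc' y (by simp)).1 hy

theorem disjoint_freeClauses : Disjoint (freeClauses L) (clausesOn (literalVars L)ᶜ) := by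
  rw [Finset.disjoint_left]
  intro c hc hc'
  obtain ⟨x, hx, hxc⟩ := exists_negLit_mem_of_mem_freeClauses hc
  exact (notMem_of_mem_clausesOn hc' _ hxc).2 (by rwa [negLit_negLit])

/-- Either both literals are negated in `L`, or one is and the other is any of the 2 (n - k)
literals on the remaining variables, where k is the size of `L`. -/
theorem Consistent.card_freeClauses (h : Consistent L) :
    (freeClauses L).card = L.card.choose 2 + L.card * (2 * (n - L.card)) := by
  rw [freeClauses, Finset.card_union_of_disjoint, Finset.card_powersetCard, card_negSet,
    Finset.card_image_of_injOn, Finset.card_product, Finset.card_product, Finset.card_compl,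
    h.card_literalVars, Finset.card_univ, Fintype.card_bool, Fintype.card_fin, mul_comm 2]
  · rintro ⟨x, y⟩ hp ⟨x', y'⟩ hp' he
    simp only [Finset.coe_product, Finset.coe_compl, Set.mem_prod, Set.mem_compl_iff,
      Finset.mem_coe, Finset.coe_univ, Set.mem_univ, and_true, fst_mem_literalVars,
      not_or] at hp hp'
    simp only [arcClause] at he
    have h1 : y ∈ ({negLit x', y'} : Finset (Literal n)) := he ▸ by simp
    have h2 : negLit x ∈ ({negLit x', y'} : Finset (Literal n)) := he ▸ by simp
    simp only [Finset.mem_insert, Finset.mem_singleton] at h1 h2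
    have h3 : y = y' := h1.resolve_left fun e => hp.2.2 (by rw [e, negLit_negLit]; exact hp'.1)
    have h4 : negLit x = negLit x' :=
      h2.resolve_right fun e => hp'.2.2 (by rw [← e, negLit_negLit]; exact hp.1)
    rw [h3, negLit_injective h4]
  · rw [Finset.disjoint_left]
    intro c hc hc'
    rw [Finset.mem_powersetCard] at hc
    obtain ⟨⟨a, b⟩, hp, rfl⟩ := Finset.mem_image.mp hc'
    simp only [Finset.mem_product, Finset.mem_compl, Finset.mem_univ, and_true,
      fst_mem_literalVars, not_or] at hp
    have h1 : b ∈ negSet L := hc.1 (by simp [arcClause])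
    exact hp.2.2 (mem_negSet.mp h1)

theorem Consistent.isClause_of_mem (h : Consistent L) {c : Finset (Literal n)}
    (hc : c ∈ insideClauses L ∪ (freeClauses L ∪ clausesOn (literalVars L)ᶜ)) : IsClause c := by
  rcases Finset.mem_union.mp hc with hc | hc
  · obtain ⟨x, hx, y, hy, hxy, rfl⟩ := exists_of_mem_insideClauses hc
    exact isClause_pair (show x.1 ≠ y.1 from h.fst_ne hx hy hxy)
  · rcases Finset.mem_union.mp hc with hc | hc
    · rcases Finset.mem_union.mp hc with hc | hc
      · rw [Finset.mem_powersetCard] at hc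
        refine ⟨hc.2, fun k hk l hl hkl => ?_⟩
        by_contra hne
        exact h.fst_ne (mem_negSet.mp (hc.1 hk)) (mem_negSet.mp (hc.1 hl))
          (fun e => hne (negLit_injective e)) hkl
      · obtain ⟨⟨a, b⟩, hp, rfl⟩ := Finset.mem_image.mp hc
        simp only [Finset.mem_product, Finset.mem_compl, Finset.mem_univ, and_true] at hp
        refine isClause_pair fun e => hp.2 ?_
        rw [← show a.1 = b.1 from e]
        exact fst_mem_literalVars.mpr (Or.inl hp.1)
    · exact (mem_clausesOn.mp hc).1

/-- No implication enters `L` exactly when all clauses are of the three allowed kinds. -/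
theorem Consistent.no_enter_iff (h : Consistent L) {F : Finset (Finset (Literal n))}
    (hF : F ⊆ clausesOn Finset.univ) :
    (∀ x y, implies F x y → y ∈ L → x ∈ L) ↔
      F ⊆ insideClauses L ∪ (freeClauses L ∪ clausesOn (literalVars L)ᶜ) := by
  constructor
  · intro hno c hc
    have hcl := (mem_clausesOn.mp (hF hc)).1
    obtain ⟨a, b, hab, rfl⟩ := hcl.exists_pair
    have inside : ∀ a b : Literal n, a.1 ≠ b.1 → ({a, b} : Finset (Literal n)) ∈ F → b ∈ L →
        ({a, b} : Finset (Literal n)) ∈ insideClauses L := by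
      intro a b hab hc hb
      have h1 : negLit a ∈ L := hno (negLit a) b (by rwa [implies, negLit_negLit]) hb
      have := mem_insideClauses_of_pair h1 hb fun e => hab (by simpa [negLit] using congrArg Prod.fst e)
      rwa [negLit_negLit] at this
    have free : ∀ a b : Literal n, negLit a ∈ L → b.1 ∉ literalVars L →
        ({a, b} : Finset (Literal n)) ∈ freeClauses L := by
      intro a b ha hb
      refine Finset.mem_union_right _ (Finset.mem_image.mpr ⟨(negLit a, b), ?_, ?_⟩)
      · simp [ha, hb]
      · simp [arcClause, negLit_negLit]
    by_cases hb : b ∈ L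
    · exact Finset.mem_union_left _ (inside a b hab hc hb)
    by_cases ha : a ∈ L
    · rw [Finset.pair_comm] at hc ⊢
      exact Finset.mem_union_left _ (inside b a hab.symm hc ha)
    refine Finset.mem_union_right _ ?_
    by_cases ha' : negLit a ∈ L
    · refine Finset.mem_union_left _ ?_
      by_cases hb' : negLit b ∈ L
      · refine Finset.mem_union_left _ (Finset.mem_powersetCard.mpr ⟨?_, hcl.1⟩)
        intro z hz
        rw [mem_negSet]
        rcases Finset.mem_insert.mp hz with rfl | hz
        · exact ha'
        · rwa [Finset.mem_singleton.mp hz]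
      · exact free a b ha' fun hv => (fst_mem_literalVars.mp hv).elim hb hb'
    · by_cases hb' : negLit b ∈ L
      · rw [Finset.pair_comm]
        exact Finset.mem_union_left _
          (free b a hb' fun hv => (fst_mem_literalVars.mp hv).elim ha ha')
      · refine Finset.mem_union_right _ (mem_clausesOn.mpr ⟨hcl, fun z hz => ?_⟩)
        rw [Finset.mem_compl, fst_mem_literalVars]
        rcases Finset.mem_insert.mp hz with rfl | hz
        · tauto
        · rw [Finset.mem_singleton.mp hz]
          tauto
  · intro hsub x y hxy hy
    have h1 := (h.mem_insideClauses_iff (hsub hxy)).mpr ⟨y, by simp, hy⟩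
    obtain ⟨p, hp, q, hq, _, he⟩ := exists_of_mem_insideClauses h1
    have h2 : negLit p ∈ ({negLit x, y} : Finset (Literal n)) := he ▸ by simp
    rw [Finset.mem_insert, Finset.mem_singleton] at h2
    rcases h2 with h2 | h2
    · rwa [← negLit_injective h2]
    · exact absurd (h2 ▸ hy) (h p hp)

/-- Making every literal of `L` false satisfies all inside and free clauses, and does not affect the
clauses on the other variables. -/
theorem Consistent.sat_inter_iff (h : Consistent L) {F : Finset (Finset (Literal n))}
    (hF : F ⊆ insideClauses L ∪ (freeClauses L ∪ clausesOn (literalVars L)ᶜ)) :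
    Sat (F ∩ clausesOn (literalVars L)ᶜ) ↔ Sat F := by
  constructor
  · rintro ⟨v, hv⟩
    set v' : Fin n → Bool := fun i =>
      if (i, true) ∈ L then false else if (i, false) ∈ L then true else v i with hv'
    have hneg : ∀ x ∈ L, v' (negLit x).1 = (negLit x).2 := by
      rintro ⟨i, b⟩ hx
      cases b with
      | true => simp [hv', negLit, hx]
      | false =>
        have : (i, true) ∉ L := h _ hx
        simp [hv', negLit, hx, this]
    refine ⟨v', fun c hc => ?_⟩
    rcases Finset.mem_union.mp (hF hc) with h1 | h1
    · obtain ⟨x, hx, y, _, _, rfl⟩ := exists_of_mem_insideClauses h1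
      exact ⟨negLit x, by simp, hneg x hx⟩
    · rcases Finset.mem_union.mp h1 with h1 | h1
      · obtain ⟨x, hx, hxc⟩ := exists_negLit_mem_of_mem_freeClauses h1
        exact ⟨negLit x, hxc, hneg x hx⟩
      · obtain ⟨⟨i, b⟩, hl, hvl⟩ := hv c (Finset.mem_inter.mpr ⟨hc, h1⟩)
        refine ⟨(i, b), hl, ?_⟩
        have h2 : i ∉ literalVars L := Finset.mem_compl.mp ((mem_clausesOn.mp h1).2 _ hl)
        have h3 : ∀ b, (i, b) ∉ L := fun b hb => h2 (Finset.mem_image.mpr ⟨(i, b), hb, rfl⟩)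
        simp only [hv', h3, if_false]
        exact hvl
  · rintro ⟨v, hv⟩
    exact ⟨v, fun c hc => hv c (Finset.mem_inter.mp hc).1⟩

theorem arcsWithin_implies_inter (F : Finset (Finset (Literal n))) :
    arcsWithin (implies (F ∩ insideClauses L)) L = arcsWithin (implies F) L := by
  ext ⟨x, y⟩
  rw [mem_arcsWithin, mem_arcsWithin, implies, implies, Finset.mem_inter]
  constructor
  · rintro ⟨hx, hy, hne, hF, _⟩
    exact ⟨hx, hy, hne, hF⟩
  · rintro ⟨hx, hy, hne, hF⟩
    exact ⟨hx, hy, hne, hF, mem_insideClauses_of_pair hx hy hne⟩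

/-! ### Weighted sums over sets of clauses -/

variable {R : Type*} [CommRing R]

open Classical in
theorem Consistent.strongSum_eq (h : Consistent L) (w t : R) :
    strongSum w t L = ∑ F ∈ (insideClauses L).powerset,
      (if SymmReach (arcRel (arcsWithin (implies F) L)) then
        t ^ classCount (arcRel (arcsWithin (implies F) L)) L else 0) * w ^ F.card := by
  rw [insideClauses, sum_powerset_image h.injOn_arcClause, strongSum]
  refine Finset.sum_congr rfl fun A hA => ?_
  have hA' := Finset.mem_powerset.mp hA
  have h1 : arcsWithin (implies (A.image arcClause)) L = A := by
    ext ⟨x, y⟩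
    rw [mem_arcsWithin, implies, Finset.mem_image]
    constructor
    · rintro ⟨hx, hy, hne, p, hp, he⟩
      have h2 : p = (x, y) := h.injOn_arcClause (hA' hp) (by simp [hx, hy, hne]) he
      exact h2 ▸ hp
    · intro hxy
      have h2 := Finset.mem_offDiag.mp (hA' hxy)
      exact ⟨h2.1, h2.2.1, h2.2.2, (x, y), hxy, rfl⟩
  rw [h1, Finset.card_image_of_injOn]
  exact h.injOn_arcClause.mono (by exact_mod_cast hA')

theorem Consistent.union_subset (h : Consistent L) :
    insideClauses L ∪ (freeClauses L ∪ clausesOn (literalVars L)ᶜ) ⊆ clausesOn Finset.univ :=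
  fun _ hc => mem_clausesOn.mpr ⟨h.isClause_of_mem hc, fun _ _ => Finset.mem_univ _⟩

-- Inside, free and remaining clauses are chosen independently: the source condition only sees the
-- first kind, satisfiability only the last, and the free ones give a power of 1 + w.
open Classical in
theorem Consistent.sum_sat (h : Consistent L) (w t : R) :
    ∑ F ∈ (clausesOn (Finset.univ : Finset (Fin n))).powerset,
      (if IsSourceUnion (implies F) L ∧ Sat F then
        t ^ classCount (implies F) L * w ^ F.card else 0) =
    strongSum w t L * ((1 + w) ^ (L.card.choose 2 + L.card * (2 * (n - L.card))) *
      satSum w (literalVars L)ᶜ) := by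
  have e := sum_powerset_union_pow_card (disjoint_freeClauses (L := L)) (fun _ => 1)
    (fun F => if Sat F then (1 : R) else 0) w
  simp only [one_mul] at e
  rw [← h.card_freeClauses, ← sum_powerset_pow_card, satSum, ← e, h.strongSum_eq,
    ← sum_powerset_union_pow_card h.disjoint_inside _
      (fun F => if Sat (F ∩ clausesOn (literalVars L)ᶜ) then (1 : R) else 0),
    sum_powerset_ite_subset h.union_subset]
  · refine Finset.sum_congr rfl fun F hF => ?_
    have hF' := Finset.mem_powerset.mp hF
    have hno := (h.no_enter_iff (hF'.trans h.union_subset)).mpr hF'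
    have e1 : F ∩ (freeClauses L ∪ clausesOn (literalVars L)ᶜ) ∩ clausesOn (literalVars L)ᶜ =
        F ∩ clausesOn (literalVars L)ᶜ := by
      rw [Finset.inter_assoc, Finset.inter_eq_right.mpr Finset.subset_union_right]
    have e2 : IsSourceUnion (implies F) L ↔
        SymmReach (arcRel (arcsWithin (implies F) L)) := by
      rw [isSourceUnion_iff, and_iff_right hno]
    rw [e1, h.sat_inter_iff hF', arcsWithin_implies_inter, ← e2, classCount_arcsWithin hno]
    by_cases h1 : IsSourceUnion (implies F) L
    · by_cases h2 : Sat F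
      · simp [h1, h2]
      · simp [h2]
    · simp [h1]
  · rintro F hF ⟨hu, _⟩
    exact (h.no_enter_iff hF).mp (isSourceUnion_iff.mp hu).1

/-- The complement of a total set is its negation, and its arcs are the contrapositives of those in
`L`. -/
theorem IsTotal.isSourceUnion_compl (h : IsTotal L) {F : Finset (Finset (Literal n))}
    (hF : F ⊆ insideClauses L) (hu : IsSourceUnion (implies F) L) :
    IsSourceUnion (implies F) Lᶜ := by
  intro x y hxy hy
  rw [Finset.mem_compl] at hy ⊢
  obtain ⟨p, _, q, hq, _, he⟩ := exists_of_mem_insideClauses (hF hxy)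
  have h1 : q ∈ ({negLit x, y} : Finset (Literal n)) := he ▸ by simp
  rw [Finset.mem_insert, Finset.mem_singleton] at h1
  have h2 : negLit x ∈ L := by
    rcases h1 with rfl | rfl
    · exact hq
    · exact absurd hq hy
  refine ⟨(h x).mp h2, ?_⟩
  have h3 := (hu _ _ (skewSymm_implies F x y hxy) h2).2
  exact (skewSymm_implies F).reach_negLit_iff.mp h3

-- No arc joins `L` to its complement, so every clause is an inside clause. The digraph on `L`
-- determines its mirror image on the complement.
open Classical in
theorem IsTotal.sum_eq (h : IsTotal L) (w t : R) :
    ∑ F ∈ (clausesOn (Finset.univ : Finset (Fin n))).powerset,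
      (if IsSourceUnion (implies F) L ∧ IsSourceUnion (implies F) Lᶜ then
        t ^ classCount (implies F) L * w ^ F.card else 0) = strongSum w t L := by
  have hc := h.consistent
  have hsub : insideClauses L ⊆ clausesOn Finset.univ :=
    Finset.subset_union_left.trans hc.union_subset
  rw [hc.strongSum_eq, sum_powerset_ite_subset hsub]
  · refine Finset.sum_congr rfl fun F hF => ?_
    have hF' := Finset.mem_powerset.mp hF
    have hno := (hc.no_enter_iff (hF'.trans hsub)).mpr (hF'.trans Finset.subset_union_left)
    have e2 : IsSourceUnion (implies F) L ↔
        SymmReach (arcRel (arcsWithin (implies F) L)) := by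
      rw [isSourceUnion_iff, and_iff_right hno]
    simp only [and_iff_left_of_imp (h.isSourceUnion_compl hF'), ← e2, classCount_arcsWithin hno,
      ite_mul, zero_mul]
  · rintro F hF ⟨hu, hu'⟩ c hcF
    have h1 := (hc.no_enter_iff hF).mp (isSourceUnion_iff.mp hu).1 hcF
    rw [hc.mem_insideClauses_iff h1]
    obtain ⟨a, b, _, rfl⟩ := (mem_clausesOn.mp (hF hcF)).1.exists_pair
    by_contra hno
    push Not at hno
    have ha := hno a (by simp)
    have hb := hno b (by simp)
    have h2 := (hu' (negLit a) b (by rwa [implies, negLit_negLit]) (Finset.mem_compl.mpr hb)).1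
    exact Finset.mem_compl.mp h2 ((h a).mpr ha)

/-- The assignment making `L` false works: if b in a ∨ b is false, then b is in `L`, and since ¬a →
b starts in `L`, a is true. -/
theorem sat_of_isTotal {F : Finset (Finset (Literal n))} (hF : F ⊆ clausesOn Finset.univ)
    (h : IsTotal L) (hu : IsSourceUnion (implies F) L) : Sat F := by
  refine ⟨fun i => decide ((i, true) ∉ L), fun c hc => ?_⟩
  have hv : ∀ x : Literal n, x ∉ L → decide ((x.1, true) ∉ L) = x.2 := by
    rintro ⟨i, b⟩ hx
    cases b with
    | true => simpa using hx
    | false =>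
      have := (h (i, false)).mpr hx
      simpa [negLit] using this
  obtain ⟨a, b, _, rfl⟩ := (mem_clausesOn.mp (hF hc)).1.exists_pair
  by_cases hb : b ∈ L
  · have h1 := (hu (negLit a) b (by rwa [implies, negLit_negLit]) hb).1
    exact ⟨a, by simp, hv a ((h a).mp h1)⟩
  · exact ⟨b, by simp, hv b hb⟩

/-- Inclusion-exclusion over the source components of implication digraphs. -/
theorem sum_strongCoeff_mul_satCoeff (n : ℕ) (w : R) {t : R} (ht : 2 * t = -1) :
    ∑ K ∈ (Finset.univ : Finset (Fin n)).powerset, 2 ^ K.card *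
      (strongCoeff w (-1) K.card * ((1 + w) ^ (K.card.choose 2 + K.card * (2 * (n - K.card))) *
        satCoeff w (n - K.card))) = 2 ^ n * strongCoeff w t n := by
  classical
  rw [← sum_consistent_card (fun k => strongCoeff w (-1) k *
    ((1 + w) ^ (k.choose 2 + k * (2 * (n - k))) * satCoeff w (n - k)))]
  have e1 : ∀ L ∈ Finset.univ.filter (fun L : Finset (Literal n) => Consistent L),
      strongCoeff w (-1) L.card * ((1 + w) ^ (L.card.choose 2 + L.card * (2 * (n - L.card))) *
        satCoeff w (n - L.card)) =
      ∑ F ∈ (clausesOn (Finset.univ : Finset (Fin n))).powerset,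
      (if IsSourceUnion (implies F) L ∧ Sat F then
        (-1) ^ classCount (implies F) L * w ^ F.card else 0) := by
    intro L hL
    have hL' : Consistent L := (Finset.mem_filter.mp hL).2
    rw [hL'.sum_sat, strongSum_eq_strongCoeff, satSum_eq_satCoeff, Finset.card_compl,
      Fintype.card_fin, hL'.card_literalVars]
  rw [Finset.sum_congr rfl e1, Finset.sum_comm]
  have e2 : ∑ L ∈ Finset.univ.filter (fun L : Finset (Literal n) => Consistent L),
      ∑ F ∈ (clausesOn (Finset.univ : Finset (Fin n))).powerset,
      (if L.card = n ∧ IsSourceUnion (implies F) L ∧ IsSourceUnion (implies F) Lᶜ then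
        t ^ classCount (implies F) L * w ^ F.card else 0) = 2 ^ n * strongCoeff w t n := by
    have e3 : ∀ L ∈ Finset.univ.filter (fun L : Finset (Literal n) => Consistent L),
        ∑ F ∈ (clausesOn (Finset.univ : Finset (Fin n))).powerset,
        (if L.card = n ∧ IsSourceUnion (implies F) L ∧ IsSourceUnion (implies F) Lᶜ then
          t ^ classCount (implies F) L * w ^ F.card else 0) =
        if L.card = n then strongCoeff w t L.card else 0 := by
      intro L hL
      have hL' : Consistent L := (Finset.mem_filter.mp hL).2
      by_cases hc : L.card = n
      · rw [if_pos hc, ← strongSum_eq_strongCoeff, ← (hL'.isTotal hc).sum_eq]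
        simp only [hc, true_and]
      · simp [hc]
    rw [Finset.sum_congr rfl e3,
      sum_consistent_card (fun k => if k = n then strongCoeff w t k else 0),
      Finset.sum_eq_single_of_mem Finset.univ (Finset.mem_powerset_self _)]
    · simp
    · intro K _ hK
      rw [if_neg, mul_zero]
      intro h
      exact hK ((Finset.card_eq_iff_eq_univ K).mp (by rw [h, Fintype.card_fin]))
  rw [← e2, Finset.sum_comm (t := (clausesOn (Finset.univ : Finset (Fin n))).powerset)]
  refine Finset.sum_congr rfl fun F hF => ?_
  have hF' := Finset.mem_powerset.mp hF
  by_cases hs : Sat F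
  · obtain ⟨v, hv⟩ := hs
    -- The true literals of a satisfying assignment form a total set closed under implication.
    set T : Finset (Literal n) := Finset.univ.filter fun x => v x.1 = x.2 with hTdef
    have hT : IsTotal T := by
      rintro ⟨i, b⟩
      cases b <;> simp [hTdef, negLit]
    have hup : UpClosed (implies F) T := by
      intro x y hxy hx
      obtain ⟨l, hl, hvl⟩ := hv _ hxy
      have hlT : l ∈ T := by simp [hTdef, hvl]
      rw [Finset.mem_insert, Finset.mem_singleton] at hl
      rcases hl with rfl | rfl
      · exact absurd hx ((hT x).mp hlT)
      · exact hlT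
    have key := sum_consistent_neg_one (skewSymm_implies F) hT hup ht
    have key' := congrArg (· * w ^ F.card) key
    simp only [Finset.sum_mul, ite_mul, zero_mul] at key'
    rw [← key']
    simp only [show Sat F from ⟨v, hv⟩, and_true]
  -- For unsatisfiable `F` the right side vanishes too, since a total source union would yield a
  -- satisfying assignment.
  · rw [Finset.sum_eq_zero, Finset.sum_eq_zero]
    · intro L hL
      refine if_neg fun h => hs ?_
      have hL' : Consistent L := (Finset.mem_filter.mp hL).2
      exact sat_of_isTotal hF' (hL'.isTotal h.1) h.2.1
    · intro L _
      exact if_neg fun h => hs h.2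

end Clauses

/-! ## Counting series as sums over sets of clauses or of edges -/

theorem coeff_sum_X_pow {ι : Type*} (S : Finset ι) (g : ι → ℕ) :
    ∑ A ∈ S, (PowerSeries.X : WSeries) ^ g A =
      PowerSeries.mk fun m => ((S.filter fun A => g A = m).card : ℚ) := by
  ext m
  simp [PowerSeries.coeff_X_pow, eq_comm]

section Counting

variable {n : ℕ}

theorem pair_eq_pair_iff {α : Type*} [DecidableEq α] {a b c d : α} :
    ({a, b} : Finset α) = {c, d} ↔ a = c ∧ b = d ∨ a = d ∧ b = c := by
  rw [← Finset.coe_inj]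
  push_cast
  exact Set.pair_eq_pair_iff

theorem TwoCNF.isClause (F : TwoCNF n) {c : Finset (Literal n)} (hc : c ∈ F.clauses) :
    IsClause c := ⟨F.card_eq_two c hc, F.distinct_vars c hc⟩

theorem TwoCNF.subset_clausesOn (F : TwoCNF n) : F.clauses ⊆ clausesOn Finset.univ :=
  fun _ hc => mem_clausesOn.mpr ⟨F.isClause hc, fun _ _ => Finset.mem_univ _⟩

/-- Each clause yields exactly two arcs. -/
theorem TwoCNF.ncard_arcs (F : TwoCNF n) :
    F.implicationDigraph.arcs.ncard = 2 * F.clauses.card := by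
  have h : F.implicationDigraph.arcs =
      ((Finset.univ.filter fun p => arcClause p ∈ F.clauses : Finset (Literal n × Literal n)) :
        Set (Literal n × Literal n)) := by
    ext p
    simp only [Finset.coe_filter, Finset.mem_univ, true_and]
    rfl
  rw [h, Set.ncard_coe_finset, Finset.card_eq_sum_card_fiberwise (f := arcClause) (t := F.clauses)
    fun p hp => by simpa using hp]
  rw [Finset.sum_const_nat (m := 2), mul_comm]
  intro c hc
  obtain ⟨a, b, hab, rfl⟩ := (F.isClause hc).exists_pair
  have h2 : (Finset.univ.filter fun p => arcClause p ∈ F.clauses).filter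
      (fun p => arcClause p = {a, b}) = {(negLit a, b), (negLit b, a)} := by
    have hn : ∀ x y : Literal n, negLit x = y ↔ x = negLit y := fun x y =>
      ⟨fun e => by rw [← e, negLit_negLit], fun e => by rw [e, negLit_negLit]⟩
    ext ⟨x, y⟩
    simp only [Finset.mem_filter, Finset.mem_univ, true_and, Finset.mem_insert,
      Finset.mem_singleton, Prod.mk.injEq]
    rw [← hn x a, ← hn x b]
    constructor
    · rintro ⟨_, h⟩
      exact pair_eq_pair_iff.mp h
    · intro h
      have e : arcClause (x, y) = {a, b} := pair_eq_pair_iff.mpr h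
      exact ⟨e ▸ hc, e⟩
  rw [h2, Finset.card_pair]
  intro e
  exact hab (congrArg Prod.fst (Prod.mk.inj e).2).symm

/-- Lets digraphs of satisfiable formulas be counted as satisfiable sets of clauses. -/
theorem TwoCNF.implicationDigraph_injective :
    Function.Injective (TwoCNF.implicationDigraph : TwoCNF n → ImplicationDigraph n) := by
  intro F F' h
  have key : ∀ F F' : TwoCNF n, F.implicationDigraph = F'.implicationDigraph →
      F.clauses ⊆ F'.clauses := by
    intro F F' h c hc
    obtain ⟨a, b, _, rfl⟩ := (F.isClause hc).exists_pair
    have h1 : F.implicationDigraph.Adj (negLit a) b := by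
      change {negLit (negLit a), b} ∈ F.clauses
      rwa [negLit_negLit]
    rw [h] at h1
    change {negLit (negLit a), b} ∈ F'.clauses at h1
    rwa [negLit_negLit] at h1
  exact TwoCNF.ext (Finset.Subset.antisymm (key F F' h) (key F' F h.symm))

theorem mk_implicationCount_sat (n : ℕ) :
    (PowerSeries.mk fun m => (implicationCount (fun n =>
      {D | ∃ F : TwoCNF n, F.Satisfiable ∧ F.implicationDigraph = D}) n m : ℚ) : WSeries) =
    satCoeff PowerSeries.X n := by
  classical
  simp only [satCoeff, satSum, ite_mul, one_mul, zero_mul]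
  rw [← Finset.sum_filter, coeff_sum_X_pow]
  congr 1
  ext m
  rw [implicationCount, ← Set.ncard_coe_finset]
  congr 1
  symm
  have hcl : ∀ A ∈ (((clausesOn (Finset.univ : Finset (Fin n))).powerset.filter Sat).filter
      fun A => A.card = m : Finset (Finset (Finset (Literal n)))),
      ∀ c ∈ A, IsClause c := fun A hA c hc =>
    (mem_clausesOn.mp (Finset.mem_powerset.mp
      (Finset.mem_filter.mp (Finset.mem_filter.mp hA).1).1 hc)).1
  refine Set.ncard_congr (fun A hA => (TwoCNF.mk A (fun c hc => (hcl A hA c hc).1)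
    (fun c hc => (hcl A hA c hc).2)).implicationDigraph) ?_ ?_ ?_
  · intro A hA
    have hA' := Finset.mem_filter.mp (Finset.mem_coe.mp hA)
    have hs : Sat A := (Finset.mem_filter.mp hA'.1).2
    exact ⟨⟨TwoCNF.mk A _ _, hs, rfl⟩, by rw [TwoCNF.ncard_arcs, hA'.2]⟩
  · intro A A' hA hA' h
    exact congrArg TwoCNF.clauses (TwoCNF.implicationDigraph_injective h)
  · rintro D ⟨⟨F, hF, rfl⟩, hm⟩
    rw [TwoCNF.ncard_arcs] at hm
    refine ⟨F.clauses, ?_, rfl⟩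
    rw [Finset.mem_coe, Finset.mem_filter, Finset.mem_filter, Finset.mem_powerset]
    exact ⟨⟨F.subset_clausesOn, hF⟩, by omega⟩

theorem mk_implicationCount_empty (n : ℕ) :
    (PowerSeries.mk fun m => (implicationCount (fun n => {D : ImplicationDigraph n | D.arcs = ∅})
      n m : ℚ) : WSeries) = 1 := by
  ext m
  rw [PowerSeries.coeff_mk, PowerSeries.coeff_one, implicationCount]
  split_ifs with hm
  · subst hm
    rw [Nat.cast_eq_one, Set.ncard_eq_one]
    refine ⟨(TwoCNF.mk ∅ (by simp) (by simp)).implicationDigraph, ?_⟩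
    ext D
    simp only [Set.mem_ofPred_eq, Set.mem_singleton_iff]
    constructor
    · rintro ⟨h, _⟩
      ext x y
      have h1 : ¬ D.Adj x y := fun hxy => by
        have : (x, y) ∈ D.arcs := hxy
        rw [h] at this
        exact this
      simp [h1, TwoCNF.implicationDigraph]
    · rintro rfl
      have : (TwoCNF.mk ∅ (by simp) (by simp) : TwoCNF n).implicationDigraph.arcs = ∅ := by
        ext p
        simp [ImplicationDigraph.arcs, TwoCNF.implicationDigraph]
      exact ⟨this, by rw [this]; simp⟩
  · rw [Nat.cast_eq_zero]
    convert Set.ncard_empty (ImplicationDigraph n)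
    ext D
    simp only [Set.mem_ofPred_eq, Set.mem_empty_iff_false, iff_false]
    rintro ⟨h, h'⟩
    rw [h, Set.ncard_empty] at h'
    omega

theorem mk_graphCount (n : ℕ) :
    (PowerSeries.mk fun m => (graphCount n m : ℚ) : WSeries) =
      (1 + PowerSeries.X) ^ n.choose 2 := by
  classical
  have hc : (⊤ : SimpleGraph (Fin n)).edgeFinset.card = n.choose 2 := by
    rw [SimpleGraph.card_edgeFinset_top_eq_card_choose_two, Fintype.card_fin]
  rw [← hc, ← sum_powerset_pow_card, coeff_sum_X_pow]
  congr 1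
  ext m
  rw [graphCount, ← Set.ncard_coe_finset]
  congr 1
  refine Set.ncard_congr (fun H _ => H.edgeFinset) ?_ ?_ ?_
  · intro H hH
    rw [Finset.mem_coe, Finset.mem_filter, Finset.mem_powerset]
    refine ⟨SimpleGraph.edgeFinset_mono le_top, ?_⟩
    rw [← Set.ncard_coe_finset, SimpleGraph.coe_edgeFinset]
    exact hH
  · intro H H' _ _ h
    exact SimpleGraph.edgeFinset_inj.mp h
  · intro A hA
    rw [Finset.mem_coe, Finset.mem_filter, Finset.mem_powerset] at hA
    have h1 : (SimpleGraph.fromEdgeSet (A : Set (Sym2 (Fin n)))).edgeSet = A := by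
      rw [SimpleGraph.edgeSet_fromEdgeSet, sdiff_eq_left, Set.disjoint_left]
      intro e he hd
      have := SimpleGraph.mem_edgeFinset.mp (hA.1 he)
      exact SimpleGraph.not_isDiag_of_mem_edgeSet _ this hd
    refine ⟨SimpleGraph.fromEdgeSet (A : Set (Sym2 (Fin n))), ?_, ?_⟩
    · rw [Set.mem_ofPred_eq, h1, Set.ncard_coe_finset, hA.2]
    · rw [← Finset.coe_inj, SimpleGraph.coe_edgeFinset, h1]

end Counting

/-! ## Exponential generating functions with coefficients in `WSeries` -/

/-- The series `∑ a_n z^n / n!`. -/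
noncomputable def egf (a : ℕ → WSeries) : ZWSeries :=
  PowerSeries.mk fun n => ((n.factorial : ℚ)⁻¹) • a n

theorem egf_mul (a b : ℕ → WSeries) :
    egf a * egf b = egf fun n =>
      ∑ K ∈ (Finset.univ : Finset (Fin n)).powerset, a K.card * b (n - K.card) := by
  ext1 n
  rw [PowerSeries.coeff_mul, egf, egf, egf]
  simp only [PowerSeries.coeff_mk]
  rw [Finset.Nat.sum_antidiagonal_eq_sum_range_succ
    (fun i j => ((i.factorial : ℚ)⁻¹ • a i) * ((j.factorial : ℚ)⁻¹ • b j)),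
    Finset.sum_powerset_apply_card (fun k => a k * b (n - k)), Finset.card_univ,
    Fintype.card_fin, Finset.smul_sum]
  refine Finset.sum_congr rfl fun k hk => ?_
  have hk' : k ≤ n := Nat.lt_succ_iff.mp (Finset.mem_range.mp hk)
  have h0 : ∀ m : ℕ, (m.factorial : ℚ) ≠ 0 := fun m => by exact_mod_cast m.factorial_ne_zero
  rw [smul_mul_smul_comm, ← Nat.cast_smul_eq_nsmul ℚ, smul_smul, Nat.cast_choose ℚ hk']
  congr 1
  have h1 := h0 n
  have h2 := h0 k
  have h3 := h0 (n - k)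
  field_simp

theorem hadamard_egf (a b : ℕ → WSeries) :
    hadamard (egf a) (egf b) = egf fun n => a n * b n := by
  ext1 n
  have h0 : (n.factorial : ℚ) ≠ 0 := by exact_mod_cast n.factorial_ne_zero
  simp only [hadamard, egf, PowerSeries.coeff_mk, smul_smul, mul_inv_cancel₀ h0, one_smul]

theorem constantCoeff_egf (a : ℕ → WSeries) : PowerSeries.constantCoeff (egf a) = a 0 := by
  rw [← PowerSeries.coeff_zero_eq_constantCoeff_apply, egf, PowerSeries.coeff_mk]
  simp

/-- The inverse of `(1 + w) ^ n`. -/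
noncomputable def invPow (n : ℕ) : WSeries := ((1 + PowerSeries.X : WSeries) ^ n)⁻¹

theorem pow_mul_invPow (n : ℕ) : (1 + PowerSeries.X : WSeries) ^ n * invPow n = 1 :=
  PowerSeries.mul_inv_cancel _ (by simp)

theorem invPow_mul_eq_iff {n : ℕ} {a b : WSeries} :
    invPow n * a = b ↔ a = (1 + PowerSeries.X : WSeries) ^ n * b := by
  have h := pow_mul_invPow n
  constructor
  · rintro rfl
    rw [← mul_assoc, h, one_mul]
  · rintro rfl
    rw [← mul_assoc, mul_comm (invPow n), h, one_mul]

theorem invPow_add (a b : ℕ) : invPow (a + b) = invPow a * invPow b := by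
  have h := pow_mul_invPow a
  have h' := pow_mul_invPow b
  rw [← mul_one (invPow (a + b)), invPow_mul_eq_iff, pow_add]
  linear_combination -h - (1 + PowerSeries.X : WSeries) ^ a * invPow a * h'

theorem graphEGF_eq_egf :
    graphEGF = egf fun n => (1 + PowerSeries.X : WSeries) ^ n.choose 2 := by
  simp only [graphEGF, exponentialGF, mk_graphCount, egf]

theorem satIGF_eq_egf :
    satIGF = egf fun n => ((2 ^ n : ℚ)⁻¹) • (satCoeff PowerSeries.X n * invPow (n * (n - 1))) := by
  simp only [satIGF, implicationGF, mk_implicationCount_sat, egf, invPow, smul_smul, mul_inv,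
    mul_comm]

theorem scaleZ_setIGF_eq_egf : scaleZ 2 setIGF = egf fun n => invPow (n * (n - 1)) := by
  ext1 n
  rw [scaleZ, PowerSeries.coeff_rescale]
  simp only [setIGF, implicationGF, mk_implicationCount_empty, egf, PowerSeries.coeff_mk, one_mul,
    invPow]
  rw [← map_pow, ← PowerSeries.smul_eq_C_mul, smul_smul]
  congr 1
  have : (n.factorial : ℚ) ≠ 0 := by exact_mod_cast n.factorial_ne_zero
  field_simp

theorem two_mul_choose_two (n : ℕ) : 2 * n.choose 2 = n * (n - 1) := by
  rw [Nat.choose_two_right, Nat.mul_div_cancel' (Nat.even_mul_pred_self n).two_dvd]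

theorem add_choose_two (k j : ℕ) : (k + j).choose 2 = k.choose 2 + j.choose 2 + k * j := by
  induction j with
  | zero => simp
  | succ j ih =>
    rw [← add_assoc, Nat.choose_succ_succ' (k + j) 1, Nat.choose_succ_succ' j 1, ih]
    simp only [Nat.choose_one_right]
    ring

/-- `∑ e_k / (1+w)^(k(k-1)/2) z^k / k!`, where `e_k` counts the digraphs all of whose weak components
are strongly connected, with sign `-1` for each component. -/
theorem strong_egf_mul_graphEGF :
    (egf fun k => strongCoeff PowerSeries.X (-1) k * invPow (k.choose 2)) * graphEGF = 1 := by
  rw [graphEGF_eq_egf, egf_mul]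
  ext1 n
  rw [egf, PowerSeries.coeff_mk, PowerSeries.coeff_one]
  rcases Nat.eq_zero_or_pos n with rfl | hn
  · simp [strongCoeff_zero, invPow]
  · rw [if_neg hn.ne']
    have : Nonempty (Fin n) := ⟨⟨0, hn⟩⟩
    have h := sum_strongSum_neg_one (U := Fin n) (PowerSeries.X : WSeries)
    -- With n = k + j, the exponent kj + j(j-1) drops to (j choose 2) - (k choose 2) on division by
    -- (1+w)^(n choose 2), so the weight splits into a k part and a j part.
    rw [← mul_right_inj' (a := invPow (n.choose 2))
      (fun e => by simpa [e] using pow_mul_invPow (n.choose 2)), mul_zero, Finset.mul_sum] at h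
    refine smul_eq_zero_of_right _ ((Finset.sum_congr rfl fun K _ => ?_).trans h)
    have hK : K.card ≤ n := by simpa using K.card_le_univ
    rw [strongSum_eq_strongCoeff, Finset.card_compl, Fintype.card_fin]
    obtain ⟨j, hj⟩ := Nat.exists_eq_add_of_le hK
    generalize K.card = k at hj
    subst hj
    have e1 := pow_mul_invPow (j.choose 2 + k * j)
    rw [Nat.add_sub_cancel_left, add_choose_two, add_assoc, invPow_add, ← two_mul_choose_two,
      show k * j + 2 * j.choose 2 = (j.choose 2 + k * j) + j.choose 2 by ring, pow_add]
    linear_combination -(strongCoeff PowerSeries.X (-1) k * invPow (k.choose 2) *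
      (1 + PowerSeries.X : WSeries) ^ j.choose 2) * e1

/-- Here the division is by (1+w)^(n(n-1)), the normalization of the Implication generating
function. With n = k + j, the exponent (k choose 2) + 2kj becomes -(k choose 2) - j(j-1). -/
theorem strong_egf_mul_satIGF {t : WSeries} (ht : 2 * t = -1) :
    (egf fun k => strongCoeff PowerSeries.X (-1) k * invPow (k.choose 2)) * satIGF =
      egf fun n => strongCoeff PowerSeries.X t n * invPow (n * (n - 1)) := by
  rw [satIGF_eq_egf, egf_mul]
  congr 1
  ext1 n
  have h := sum_strongCoeff_mul_satCoeff n (PowerSeries.X : WSeries) ht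
  have h0 : (2 : WSeries) ^ n ≠ 0 := pow_ne_zero n fun e => by
    have := congrArg PowerSeries.constantCoeff e
    rw [map_ofNat, map_zero] at this
    exact two_ne_zero this
  have h' := congrArg (invPow (n * (n - 1)) * ·) h
  simp only [Finset.mul_sum] at h'
  -- Multiplying by 2 ^ n = 2 ^ k * 2 ^ j cancels the 2 ^ j in the denominator of the SAT series and
  -- leaves the 2 ^ k of the consistent sets.
  rw [← mul_right_inj' h0, Finset.mul_sum, ← mul_assoc, ← mul_comm (invPow _), ← h']
  refine Finset.sum_congr rfl fun K _ => ?_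
  have hK : K.card ≤ n := by simpa using K.card_le_univ
  obtain ⟨j, hj⟩ := Nat.exists_eq_add_of_le hK
  generalize K.card = k at hj
  subst hj
  have e1 := pow_mul_invPow (k.choose 2 + k * (2 * j))
  have e2 : (2 : WSeries) ^ j * PowerSeries.C ((2 ^ j : ℚ)⁻¹) = 1 := by
    rw [← map_ofNat (PowerSeries.C (R := ℚ)) 2, ← map_pow, ← map_mul,
      mul_inv_cancel₀ (pow_ne_zero j two_ne_zero), map_one]
  rw [Nat.add_sub_cancel_left, PowerSeries.smul_eq_C_mul, ← two_mul_choose_two (k + j),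
    add_choose_two, show 2 * (k.choose 2 + j.choose 2 + k * j) =
      (k.choose 2 + k * (2 * j)) + (k.choose 2 + 2 * j.choose 2) by ring,
    invPow_add (k.choose 2 + _), invPow_add (k.choose 2) (2 * _), two_mul_choose_two, pow_add 2 k]
  linear_combination (2 ^ k * strongCoeff PowerSeries.X (-1) k * invPow (k.choose 2) *
    satCoeff PowerSeries.X j * invPow (j * (j - 1))) * (e2 - e1)

theorem sqrtSeries_strong_egf {t : WSeries} (ht : 2 * t = -1) :
    sqrtSeries (egf (strongCoeff PowerSeries.X (-1))) = egf (strongCoeff PowerSeries.X t) := by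
  set S := egf (strongCoeff PowerSeries.X t) with hS
  have hS1 : PowerSeries.constantCoeff S = 1 := by rw [hS, constantCoeff_egf, strongCoeff_zero]
  have hE : S * S = egf (strongCoeff PowerSeries.X (-1)) := by
    rw [hS, egf_mul]
    congr 1
    ext1 n
    rw [← ht, strongCoeff, ← sum_strongSum_mul_compl]
    refine Finset.sum_congr rfl fun K _ => ?_
    rw [strongSum_eq_strongCoeff, strongSum_eq_strongCoeff, Finset.card_compl, Fintype.card_fin]
  have h1 := sqrtSeries_sq (egf (strongCoeff PowerSeries.X (-1)))
    (by rw [constantCoeff_egf, strongCoeff_zero])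
  rw [← hE, ← pow_two, sq_eq_sq_iff_eq_or_eq_neg, pow_two, hE] at h1
  -- The series form a domain, so the root is determined up to sign; the constant coefficient 1
  -- excludes the negative one.
  refine h1.resolve_right fun h => ?_
  have h2 := congrArg PowerSeries.constantCoeff h
  rw [constantCoeff_sqrtSeries, map_neg, hS1] at h2
  have h3 := congrArg PowerSeries.constantCoeff h2
  norm_num at h3

end TwoSat

/-! ### Assembling the formula -/

theorem mainTheorem2 :
    TwoSat.satIGF =
      TwoSat.graphEGF *
        TwoSat.hadamard
          (TwoSat.sqrtSeries
            (TwoSat.hadamard TwoSat.graphEGF (TwoSat.invSeries TwoSat.graphEGF)))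
          (TwoSat.scaleZ 2 TwoSat.setIGF) := by
  obtain ⟨t, ht⟩ : ∃ t : TwoSat.WSeries, 2 * t = -1 :=
    ⟨PowerSeries.C (-1 / 2), by
      rw [← map_ofNat (PowerSeries.C (R := ℚ)) 2, ← map_mul]
      norm_num⟩
  have h1 := TwoSat.strong_egf_mul_graphEGF
  have h2 := TwoSat.mul_invSeries _ TwoSat.constantCoeff_graphEGF
  -- Knowing the coefficients of 1/G explicitly, the Hadamard product with G just cancels the powers
  -- of 1 + w.
  have h3 : TwoSat.invSeries TwoSat.graphEGF =
      TwoSat.egf fun k =>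
        TwoSat.strongCoeff PowerSeries.X (-1) k * TwoSat.invPow (k.choose 2) :=
    (left_inv_eq_right_inv h1 h2).symm
  have h4 : TwoSat.hadamard TwoSat.graphEGF (TwoSat.invSeries TwoSat.graphEGF) =
      TwoSat.egf (TwoSat.strongCoeff PowerSeries.X (-1)) := by
    rw [h3, TwoSat.graphEGF_eq_egf, TwoSat.hadamard_egf]
    congr 1
    ext1 n
    rw [mul_left_comm, TwoSat.pow_mul_invPow, mul_one]
  rw [h4, TwoSat.sqrtSeries_strong_egf ht, TwoSat.scaleZ_setIGF_eq_egf, TwoSat.hadamard_egf,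
    ← TwoSat.strong_egf_mul_satIGF ht, ← mul_assoc, mul_comm TwoSat.graphEGF, h1, one_mul]
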